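/- All graphs are finite and simple. For a vertex $v$ of a graph $G$ let $N_G[v]=N_G(v)\cup\{v\}$ be its closed neighborhood. A sequence $(v_1,\dots,v_k)$ of vertices of $G$ is a closed neighborhood sequence if $N_G[v_i]\setminus\bigcup_{j=1}^{i-1}N_G[v_j]\neq\emptyset$ for every $i\in\{2,\dots,k\}$. The Grundy domination number $\gamma_{\mathrm{gr}}(G)$ is the maximum length of a closed neighborhood sequence in $G$. Let $G$ be a connected cubic graph of order $n$. Then $\gamma_{\mathrm{gr}}(G)=\frac n2$ if and only if $G$ is isomorphic to one of the following eight graphs: $K_{3,3}$, $Y_2$, $Y_3$, $N_{YY}$, $K_3\,\square\,K_2$, the $3$-cube $Q_3$, $TQ_3$, the Petersen graph. Here $\square$ denotes the Cartesian product of graphs. Let $Y$ be the graph obtained from $K_{2,3}$ by adding an edge between two vertices of degree $2$; it has exactly one vertex of degree $2$, denoted $\alpha_Y$. The graph $Y_2$ is obtained from two disjoint copies of $Y$ by joining their vertices $\alpha_Y$ by an edge. The graph $Y_3$ is obtained from $K_{1,3}$ and three disjoint copies of $Y$ by identifying each leaf of $K_{1,3}$ with the vertex $\alpha_Y$ of its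 own copy of $Y$. The graph $N_{YY}$ is the cubic graph obtained from two disjoint copies of the diamond $K_4-e$ by adding two edges between the two copies, so that each vertex of degree $2$ of one diamond is joined to a different vertex of degree $2$ of the other. The graph $TQ_3$ is obtained from two disjoint $4$-cycles $a,b,c,d,a$ and $a',b',c',d',a'$ by adding the edges $aa'$, $bb'$, $cd'$ and $dc'$. -/

import Mathlib

namespace GrundyCubic

open SimpleGraph

/-- The closed neighborhood `N[v] = N(v) ∪ {v}`. -/
def closedNbhd {V : Type*} (G : SimpleGraph V) (v : V) : Set V :=
  G.neighborSet v ∪ {v}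

/-- A sequence `(s 0, …, s (k - 1))` of vertices is a closed neighborhood sequence if every term
dominates a vertex that is dominated by no earlier term.
(For the first term the condition holds automatically, since `N[v]` is nonempty.) -/
def IsClosedNbhdSeq {V : Type*} (G : SimpleGraph V) {k : ℕ} (s : Fin k → V) : Prop :=
  ∀ i : Fin k, (closedNbhd G (s i) \ ⋃ (j : Fin k) (_ : j < i), closedNbhd G (s j)).Nonempty

/-- The Grundy domination number: the maximum length of a closed neighborhood sequence. -/
noncomputable def grundyDominationNumber {V : Type*} (G : SimpleGraph V) : ℕ :=
  sSup {k : ℕ | ∃ s : Fin k → V, IsClosedNbhdSeq G s}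

/-- The terms of a closed neighborhood sequence are pairwise distinct. -/
theorem IsClosedNbhdSeq.injective {V : Type*} {G : SimpleGraph V} {k : ℕ} {s : Fin k → V}
    (hs : IsClosedNbhdSeq G s) : Function.Injective s := by
  have key : ∀ i j : Fin k, i < j → s i ≠ s j := by
    intro i j hij h
    obtain ⟨x, hx, hx'⟩ := hs j
    exact hx' (Set.mem_iUnion₂.2 ⟨i, hij, by rw [h]; exact hx⟩)
  intro i j h
  rcases lt_trichotomy i j with hij | hij | hij
  · exact absurd h (key i j hij)
  · exact hij
  · exact absurd h.symm (key j i hij)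

/-- In a finite graph the Grundy domination number is an attained maximum. -/
theorem isGreatest_grundyDominationNumber {V : Type*} [Fintype V] (G : SimpleGraph V) :
    IsGreatest {k : ℕ | ∃ s : Fin k → V, IsClosedNbhdSeq G s} (grundyDominationNumber G) := by
  have hb : BddAbove {k : ℕ | ∃ s : Fin k → V, IsClosedNbhdSeq G s} := by
    refine ⟨Fintype.card V, ?_⟩
    rintro k ⟨s, hs⟩
    simpa using Fintype.card_le_of_injective s hs.injective
  have hne : {k : ℕ | ∃ s : Fin k → V, IsClosedNbhdSeq G s}.Nonempty :=
    ⟨0, Fin.elim0, fun i => i.elim0⟩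
  exact ⟨Nat.sSup_mem hne hb, fun k hk => le_csSup hb hk⟩

/-- `K_{3,3}`. -/
def K33 : SimpleGraph (Fin 3 ⊕ Fin 3) :=
  completeBipartiteGraph (Fin 3) (Fin 3)

/-- The graph `Y`: `K_{2,3}` with an edge added between two of the vertices of degree 2
(these are the vertices `inr _`). -/
def Y : SimpleGraph (Fin 2 ⊕ Fin 3) :=
  completeBipartiteGraph (Fin 2) (Fin 3) ⊔ edge (Sum.inr 0) (Sum.inr 1)

/-- The only vertex of `Y` of degree 2. -/
def alphaY : Fin 2 ⊕ Fin 3 := Sum.inr 2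

/-- `Y_2`: two disjoint copies of `Y` whose vertices of degree 2 are joined by an edge. -/
def Y2 : SimpleGraph ((Fin 2 ⊕ Fin 3) ⊕ (Fin 2 ⊕ Fin 3)) :=
  (Y ⊕g Y) ⊔ edge (Sum.inl alphaY) (Sum.inr alphaY)

/-- `Y_3`: each leaf of `K_{1,3}` is identified with the vertex of degree 2 of its own copy of `Y`.
That is, a new vertex `inl ()` is joined to the vertices of degree 2 of three disjoint copies of `Y`;
the vertices of the `i`-th copy are the `inr (i, v)`. -/
def Y3 : SimpleGraph (Unit ⊕ (Fin 3 × (Fin 2 ⊕ Fin 3))) :=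
  ((⊥ : SimpleGraph Unit) ⊕g ((⊥ : SimpleGraph (Fin 3)) □ Y)) ⊔
    ⨆ i : Fin 3, edge (Sum.inl ()) (Sum.inr (i, alphaY))

/-- The diamond `K_4 - e`; its vertices of degree 2 are `0` and `1`. -/
def diamond : SimpleGraph (Fin 4) :=
  (completeGraph (Fin 4)).deleteEdges {s(0, 1)}

/-- `N_YY`, the 2-necklace: the cubic graph obtained from two disjoint diamonds by adding two
edges between them (which necessarily join the vertices of degree 2). -/
def NYY : SimpleGraph (Fin 4 ⊕ Fin 4) :=
  (diamond ⊕g diamond) ⊔ edge (Sum.inl 0) (Sum.inr 0) ⊔ edge (Sum.inl 1) (Sum.inr 1)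

/-- The Hamming graph `K_3 □ K_2`. -/
def K3boxK2 : SimpleGraph (Fin 3 × Fin 2) :=
  completeGraph (Fin 3) □ completeGraph (Fin 2)

/-- The 3-cube `Q_3 = K_2 □ K_2 □ K_2`. -/
def Q3 : SimpleGraph ((Fin 2 × Fin 2) × Fin 2) :=
  (completeGraph (Fin 2) □ completeGraph (Fin 2)) □ completeGraph (Fin 2)

/-- The twisted cube `TQ_3`: two disjoint 4-cycles `a b c d` and `a' b' c' d'` (numbered `0 1 2 3`)
together with the edges `aa'`, `bb'`, `cd'`, `dc'`. -/
def TQ3 : SimpleGraph (Fin 4 ⊕ Fin 4) :=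
  (cycleGraph 4 ⊕g cycleGraph 4) ⊔ edge (Sum.inl 0) (Sum.inr 0) ⊔ edge (Sum.inl 1) (Sum.inr 1)
    ⊔ edge (Sum.inl 2) (Sum.inr 3) ⊔ edge (Sum.inl 3) (Sum.inr 2)

/-- The 5-cycle drawn as a pentagram: `i` is adjacent to `i + 2` and `i - 2` modulo 5. -/
def pentagram : SimpleGraph (Fin 5) :=
  SimpleGraph.fromRel fun i j => j = i + 2

/-- The Petersen graph: an outer 5-cycle and an inner pentagram, with the `i`-th outer vertex
joined to the `i`-th inner vertex. -/
def petersen : SimpleGraph (Fin 5 ⊕ Fin 5) :=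
  (cycleGraph 5 ⊕g pentagram) ⊔ ⨆ i : Fin 5, edge (Sum.inl i) (Sum.inr i)

end GrundyCubic

namespace GrundyCubic

open SimpleGraph

/-! For each of the eight graphs an explicit sequence gives the lower bound. For the upper bound, a
closed neighborhood sequence together with one newly dominated vertex per term selects a triangular
submatrix with nonzero diagonal in any matrix with the zero pattern of A + I. Its length is
therefore at most the rank (`IsClosedNbhdSeq.length_le`), and matrices of rank at most n/2 over
`ZMod 7` are given in factored form.

The converse is an accounting argument. In a cubic graph a vertex that is already dominated adds at
most two new vertices, because its closed neighborhood contains both itself and a term that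
dominated it. Hence every nonempty dominated set D, reached in k steps, can be grown to V at a price
of at most two vertices per step, and extremality forces 2k ≤ |D|. The first step costs four
vertices, an excess of 2; every step that gains exactly one vertex earns back 1. Once the excess is
0, no closed neighborhood may contain exactly one undominated vertex (`Extremal.card_sdiff_ne_one`),
and the last greedy step must then uncover two vertices with equal closed neighborhoods
(`Extremal.exists_twins`).

If there are no such twins, excess 0 means that everything is dominated. Two single gains around a
triangle or a 4-cycle then bound the whole graph and identify it. In girth at least 5, growth from a
ball remains tree-like as long as enough vertices are left; since it cannot go on forever, the order
is at most 10 and the graph is the Petersen graph.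

If there are twins, they lie in a diamond. Sets of excess 0 built around diamonds leave further
twins, hence further diamonds, and `Extremal.mem_of_twins` and `Extremal.not_disjoint` force these
pieces to touch. This leaves only N_YY, Y_2 and Y_3. -/

/-! ### Closed neighborhood sequences and the rank bound -/

theorem mem_closedNbhd {V : Type*} {G : SimpleGraph V} {v w : V} :
    w ∈ closedNbhd G v ↔ G.Adj v w ∨ w = v := Iff.rfl

theorem isClosedNbhdSeq_iff {V : Type*} {G : SimpleGraph V} {k : ℕ} {s : Fin k → V} :
    IsClosedNbhdSeq G s ↔
      ∃ x : Fin k → V, ∀ i, x i ∈ closedNbhd G (s i) ∧ ∀ j < i, x i ∉ closedNbhd G (s j) := by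
  constructor
  · intro h
    choose x hx using h
    exact ⟨x, fun i => ⟨(hx i).1, fun j hj hm => (hx i).2 (Set.mem_iUnion₂.2 ⟨j, hj, hm⟩)⟩⟩
  · rintro ⟨x, hx⟩ i
    refine ⟨x i, (hx i).1, fun hm => ?_⟩
    obtain ⟨j, hj, hm⟩ := Set.mem_iUnion₂.1 hm
    exact (hx i).2 j hj hm

/-- If a matrix with the zero pattern of the closed neighborhoods factors through dimension `r`,
then closed neighborhood sequences have length at most `r`. -/
theorem IsClosedNbhdSeq.length_le {V F : Type*} [Field F] {G : SimpleGraph V} {r k : ℕ}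
    (P Q : V → Fin r → F)
    (hPQ : ∀ u v, P u ⬝ᵥ Q v ≠ 0 ↔ G.Adj u v ∨ v = u)
    {s : Fin k → V} (hs : IsClosedNbhdSeq G s) : k ≤ r := by
  obtain ⟨x, hx⟩ := isClosedNbhdSeq_iff.1 hs
  let A : Matrix (Fin k) (Fin r) F := Matrix.of fun i l => P (s i) l
  let B : Matrix (Fin r) (Fin k) F := Matrix.of fun l j => Q (x j) l
  have hAB : ∀ i j, (A * B) i j = P (s i) ⬝ᵥ Q (x j) := fun i j => rfl
  -- For i < j, no earlier term `s i` dominates the vertex `x j` that is new at step j.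
  have htri : (A * B).IsLowerTriangular := by
    intro i j hij
    rw [hAB]
    by_contra h
    exact (hx j).2 i hij ((hPQ _ _).1 h)
  have hdet : (A * B).det ≠ 0 := by
    rw [Matrix.det_of_isLowerTriangular _ htri, Finset.prod_ne_zero_iff]
    intro i _
    rw [hAB]
    exact (hPQ _ _).2 (hx i).1
  have h1 := Matrix.rank_of_det_mem_nonZeroDivisors (mem_nonZeroDivisors_of_ne_zero hdet)
  have h2 := Matrix.rank_mul_le_left A B
  have h3 := Matrix.rank_le_width A
  simp only [Fintype.card_fin] at h1
  omega

/-- The factorization bounds the length from above, and `s` with its newly dominated vertices `x`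
attains the bound. All conditions are finite checks over `ZMod 7`. -/
theorem grundy_eq_of_certificate {V : Type*} [Fintype V] (G : SimpleGraph V) {r : ℕ}
    (P Q : V → Fin r → ZMod 7)
    (hPQ : ∀ u v, P u ⬝ᵥ Q v ≠ 0 ↔ G.Adj u v ∨ v = u)
    (s x : Fin r → V)
    (hx : ∀ i, (G.Adj (s i) (x i) ∨ x i = s i) ∧ ∀ j < i, ¬ (G.Adj (s j) (x i) ∨ x i = s j)) :
    grundyDominationNumber G = r := by
  have : Fact (Nat.Prime 7) := ⟨by norm_num⟩
  obtain ⟨⟨t, ht⟩, hmax⟩ := isGreatest_grundyDominationNumber G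
  exact le_antisymm (ht.length_le P Q hPQ) (hmax ⟨s, isClosedNbhdSeq_iff.2 ⟨x, hx⟩⟩)

theorem IsClosedNbhdSeq.map {V W : Type*} {G : SimpleGraph V} {H : SimpleGraph W} (e : G ≃g H)
    {k : ℕ} {s : Fin k → V} (hs : IsClosedNbhdSeq G s) : IsClosedNbhdSeq H (e ∘ s) := by
  obtain ⟨x, hx⟩ := isClosedNbhdSeq_iff.1 hs
  refine isClosedNbhdSeq_iff.2 ⟨e ∘ x, fun i => ?_⟩
  simpa [mem_closedNbhd, e.map_adj_iff] using hx i

theorem grundyDominationNumber_congr {V W : Type*} {G : SimpleGraph V} {H : SimpleGraph W}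
    (e : G ≃g H) : grundyDominationNumber G = grundyDominationNumber H := by
  unfold grundyDominationNumber
  congr 1
  ext k
  refine ⟨fun ⟨s, hs⟩ => ⟨_, hs.map e⟩, fun ⟨s, hs⟩ => ⟨_, hs.map e.symm⟩⟩

theorem grundy_eq_half_of_iso {V W : Type*} [Fintype V] [Fintype W] {G : SimpleGraph V}
    {H : SimpleGraph W} {r : ℕ} (hH : grundyDominationNumber H = r)
    (hr : Fintype.card W = 2 * r) (e : G ≃g H) :
    (grundyDominationNumber G : ℚ) = (Fintype.card V : ℚ) / 2 := by
  rw [grundyDominationNumber_congr e, hH, Fintype.card_congr e.toEquiv, hr]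
  push_cast
  ring

/-! ### Decidable adjacency in the eight graphs -/

instance decidableRelCompleteBipartiteGraph {V W : Type*} :
    DecidableRel (completeBipartiteGraph V W).Adj := fun a b =>
  inferInstanceAs (Decidable (a.isLeft ∧ b.isRight ∨ a.isRight ∧ b.isLeft))

instance (priority := high) decidableRelEdge {V : Type*} [DecidableEq V] (s t : V) :
    DecidableRel (edge s t).Adj := fun v w => decidable_of_iff _ (edge_adj s t v w).symm

instance decidableRelSup {V : Type*} (G H : SimpleGraph V)
    [DecidableRel G.Adj] [DecidableRel H.Adj] : DecidableRel (G ⊔ H).Adj := fun v w =>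
  inferInstanceAs (Decidable (G.Adj v w ∨ H.Adj v w))

instance decidableRelISup {V ι : Type*} [Fintype ι] (H : ι → SimpleGraph V)
    [∀ i, DecidableRel (H i).Adj] : DecidableRel (⨆ i, H i).Adj := fun a b =>
  decidable_of_iff (∃ i, (H i).Adj a b) iSup_adj.symm

instance decidableRelSum {V W : Type*} (G : SimpleGraph V) (H : SimpleGraph W)
    [DecidableRel G.Adj] [DecidableRel H.Adj] : DecidableRel (G ⊕g H).Adj := fun
  | .inl a, .inl b => inferInstanceAs (Decidable (G.Adj a b))
  | .inr a, .inr b => inferInstanceAs (Decidable (H.Adj a b))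
  | .inl _, .inr _ => isFalse (by simp)
  | .inr _, .inl _ => isFalse (by simp)

instance decidableRelBoxProd {V W : Type*} [DecidableEq V] [DecidableEq W] (G : SimpleGraph V)
    (H : SimpleGraph W) [DecidableRel G.Adj] [DecidableRel H.Adj] : DecidableRel (G □ H).Adj :=
  fun _ _ => decidable_of_iff _ boxProd_adj.symm

instance decidableRelCompleteGraph {V : Type*} [DecidableEq V] :
    DecidableRel (completeGraph V).Adj := fun v w => inferInstanceAs (Decidable (v ≠ w))

instance (priority := high) decidableRelCycleGraph (n : ℕ) :
    DecidableRel (cycleGraph (n + 2)).Adj := fun _ _ => decidable_of_iff _ cycleGraph_adj.symm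

instance : DecidableRel K33.Adj := decidableRelCompleteBipartiteGraph

instance : DecidableRel Y.Adj := decidableRelSup _ _

instance : DecidableRel Y2.Adj := decidableRelSup _ _

instance : DecidableRel Y3.Adj := decidableRelSup _ _

instance : DecidableRel diamond.Adj := fun a b =>
  decidable_of_iff ((completeGraph (Fin 4)).Adj a b ∧ s(a, b) ≠ s(0, 1)) (by simp [diamond])

instance : DecidableRel NYY.Adj := decidableRelSup _ _

instance : DecidableRel K3boxK2.Adj := decidableRelBoxProd _ _

instance : DecidableRel Q3.Adj := decidableRelBoxProd _ _

instance : DecidableRel TQ3.Adj := decidableRelSup _ _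

instance : DecidableRel pentagram.Adj := fun i j =>
  decidable_of_iff (i ≠ j ∧ (j = i + 2 ∨ i = j + 2)) (by simp [pentagram])

instance : DecidableRel petersen.Adj := decidableRelSup _ _

/-! ### Certificates for the eight graphs -/

theorem grundy_K33 : grundyDominationNumber K33 = 3 :=
  grundy_eq_of_certificate K33
    (Sum.elim ![![1, 0, 0], ![0, 1, 0], ![0, 0, 1]] ![![3, 4, 1], ![4, 5, 5], ![1, 5, 1]])
    (Sum.elim ![![1, 0, 0], ![0, 1, 0], ![0, 0, 1]] ![![1, 1, 1], ![1, 2, 3], ![1, 3, 6]])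
    (by decide +kernel)
    ![Sum.inl 0, Sum.inl 1, Sum.inl 2]
    ![Sum.inl 0, Sum.inl 1, Sum.inl 2]
    (by decide +kernel)

theorem grundy_Y2 : grundyDominationNumber Y2 = 5 :=
  grundy_eq_of_certificate Y2
    (Sum.elim (Sum.elim ![![1, 0, 1, 0, 0], ![0, 6, 2, 0, 0]] ![![2, 1, 0, 0, 0], ![2, 1, 0, 0, 0], ![1, 1, 5, 0, 0]]) (Sum.elim ![![0, 0, 0, 1, 0], ![0, 0, 0, 0, 6]] ![![0, 0, 0, 2, 1], ![0, 0, 0, 2, 1], ![0, 0, 1, 1, 1]]))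
    (Sum.elim (Sum.elim ![![1, 0, 0, 0, 0], ![0, 1, 0, 0, 0]] ![![1, 6, 0, 0, 0], ![1, 6, 0, 0, 0], ![0, 0, 1, 0, 0]]) (Sum.elim ![![0, 0, 0, 1, 0], ![0, 0, 0, 0, 1]] ![![0, 0, 0, 1, 6], ![0, 0, 0, 1, 6], ![1, 5, 6, 1, 5]]))
    (by decide +kernel)
    ![Sum.inl (Sum.inl 0), Sum.inl (Sum.inl 1), Sum.inl (Sum.inr 2), Sum.inr (Sum.inr 2), Sum.inr (Sum.inl 0)]
    ![Sum.inl (Sum.inl 0), Sum.inl (Sum.inl 1), Sum.inr (Sum.inr 2), Sum.inr (Sum.inl 0), Sum.inr (Sum.inr 0)]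
    (by decide +kernel)

theorem grundy_Y3 : grundyDominationNumber Y3 = 8 :=
  grundy_eq_of_certificate Y3
    (Sum.elim (fun _ => ![1, 0, 0, 1, 0, 0, 0, 0]) (fun u => ![Sum.elim ![![0, 1, 0, 1, 0, 0, 0, 0], ![0, 0, 6, 2, 0, 0, 0, 0]] ![![0, 2, 1, 0, 0, 0, 0, 0], ![0, 2, 1, 0, 0, 0, 0, 0], ![1, 1, 1, 6, 0, 0, 0, 0]], Sum.elim ![![0, 0, 0, 0, 1, 0, 0, 0], ![0, 0, 0, 0, 0, 6, 0, 0]] ![![0, 0, 0, 0, 2, 1, 0, 0], ![0, 0, 0, 0, 2, 1, 0, 0], ![1, 0, 0, 0, 1, 1, 0, 0]], Sum.elim ![![0, 0, 0, 0, 0, 0, 1, 0], ![0, 0, 0, 0, 0, 0, 0, 6]] ![![0, 0, 0, 0, 0, 0, 2, 1], ![0, 0, 0, 0, 0, 0, 2, 1], ![1, 0, 0, 0, 0, 0, 1, 1]]] u.1 u.2))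
    (Sum.elim (fun _ => ![1, 0, 0, 0, 0, 0, 0, 0]) (fun u => ![Sum.elim ![![0, 1, 0, 0, 0, 0, 0, 0], ![0, 0, 1, 0, 0, 0, 0, 0]] ![![0, 1, 6, 0, 0, 0, 0, 0], ![0, 1, 6, 0, 0, 0, 0, 0], ![0, 0, 0, 1, 0, 0, 0, 0]], Sum.elim ![![0, 0, 0, 0, 1, 0, 0, 0], ![0, 0, 0, 0, 0, 1, 0, 0]] ![![0, 0, 0, 0, 1, 6, 0, 0], ![0, 0, 0, 0, 1, 6, 0, 0], ![0, 6, 2, 1, 1, 5, 0, 0]], Sum.elim ![![0, 0, 0, 0, 0, 0, 1, 0], ![0, 0, 0, 0, 0, 0, 0, 1]] ![![0, 0, 0, 0, 0, 0, 1, 6], ![0, 0, 0, 0, 0, 0, 1, 6], ![0, 6, 2, 1, 0, 0, 1, 5]]] u.1 u.2))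
    (by decide +kernel)
    ![Sum.inr (0, Sum.inl 0), Sum.inr (0, Sum.inl 1), Sum.inr (0, Sum.inr 2), Sum.inl (), Sum.inr (1, Sum.inr 2), Sum.inr (1, Sum.inl 0), Sum.inr (2, Sum.inr 2), Sum.inr (2, Sum.inl 0)]
    ![Sum.inr (0, Sum.inl 0), Sum.inr (0, Sum.inl 1), Sum.inl (), Sum.inr (1, Sum.inr 2), Sum.inr (1, Sum.inl 0), Sum.inr (1, Sum.inr 0), Sum.inr (2, Sum.inl 0), Sum.inr (2, Sum.inr 0)]
    (by decide +kernel)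

theorem grundy_NYY : grundyDominationNumber NYY = 4 :=
  grundy_eq_of_certificate NYY
    (Sum.elim ![![1, 0, 1, 1], ![0, 1, 1, 0], ![1, 1, 1, 0], ![1, 1, 1, 0]] ![![1, 0, 0, 1], ![0, 1, 0, 0], ![0, 0, 0, 1], ![0, 0, 0, 1]])
    (Sum.elim ![![1, 0, 0, 0], ![0, 1, 0, 0], ![0, 0, 1, 0], ![0, 0, 1, 0]] ![![0, 0, 0, 1], ![6, 1, 0, 1], ![0, 1, 6, 1], ![0, 1, 6, 1]])
    (by decide +kernel)
    ![Sum.inl 0, Sum.inl 2, Sum.inl 1, Sum.inr 0]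
    ![Sum.inl 0, Sum.inl 1, Sum.inr 1, Sum.inr 2]
    (by decide +kernel)

theorem grundy_K3boxK2 : grundyDominationNumber K3boxK2 = 3 :=
  grundy_eq_of_certificate K3boxK2
    (fun u => ![![![1, 1, 1], ![1, 2, 3], ![1, 3, 6]], ![![1, 0, 0], ![0, 1, 0], ![0, 0, 1]]] u.2 u.1)
    (fun u => ![![![1, 0, 0], ![0, 1, 0], ![0, 0, 1]], ![![3, 4, 1], ![4, 5, 5], ![1, 5, 1]]] u.2 u.1)
    (by decide +kernel)
    ![(0, 0), (1, 0), (2, 0)]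
    ![(0, 0), (1, 1), (2, 1)]
    (by decide +kernel)

theorem grundy_Q3 : grundyDominationNumber Q3 = 4 :=
  grundy_eq_of_certificate Q3
    (fun u => ![![![![2, 4, 0, 4], ![6, 1, 1, 0]], ![![4, 0, 4, 3], ![0, 5, 1, 2]]], ![![![1, 0, 0, 0], ![0, 1, 0, 0]], ![![0, 0, 0, 1], ![0, 0, 1, 0]]]] u.2 u.1.1 u.1.2)
    (fun u => ![![![![1, 0, 0, 0], ![0, 1, 0, 0]], ![![0, 0, 0, 1], ![0, 0, 1, 0]]], ![![![5, 5, 0, 5], ![1, 3, 6, 0]], ![![5, 0, 5, 1], ![0, 4, 3, 3]]]] u.2 u.1.1 u.1.2)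
    (by decide +kernel)
    ![((0, 0), 0), ((0, 1), 0), ((1, 1), 0), ((1, 0), 0)]
    ![((0, 0), 0), ((1, 1), 0), ((1, 1), 1), ((1, 0), 1)]
    (by decide +kernel)

theorem grundy_TQ3 : grundyDominationNumber TQ3 = 4 :=
  grundy_eq_of_certificate TQ3
    (Sum.elim ![![4, 6, 0, 6], ![1, 6, 1, 0], ![0, 5, 1, 6], ![4, 0, 2, 3]] ![![1, 0, 0, 0], ![0, 1, 0, 0], ![0, 0, 0, 1], ![0, 0, 1, 0]])
    (Sum.elim ![![1, 0, 0, 0], ![0, 1, 0, 0], ![0, 0, 1, 0], ![0, 0, 0, 1]] ![![3, 4, 1, 0], ![3, 2, 0, 3], ![0, 6, 6, 1], ![4, 0, 3, 2]])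
    (by decide +kernel)
    ![Sum.inl 0, Sum.inl 1, Sum.inl 2, Sum.inl 3]
    ![Sum.inl 0, Sum.inl 2, Sum.inr 3, Sum.inr 2]
    (by decide +kernel)

/-- The factored matrix is A - I; over the rationals it has rank 5 because 1 is an eigenvalue of
multiplicity 5. -/
theorem grundy_petersen : grundyDominationNumber petersen = 5 :=
  grundy_eq_of_certificate petersen
    (Sum.elim ![![6, 1, 0, 0, 1], ![1, 6, 1, 0, 0], ![0, 1, 6, 1, 0], ![0, 0, 1, 6, 1], ![1, 0, 0, 1, 6]] ![![1, 0, 0, 0, 0], ![0, 1, 0, 0, 0], ![0, 0, 1, 0, 0], ![0, 0, 0, 1, 0], ![0, 0, 0, 0, 1]])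
    (Sum.elim ![![1, 0, 0, 0, 0], ![0, 1, 0, 0, 0], ![0, 0, 1, 0, 0], ![0, 0, 0, 1, 0], ![0, 0, 0, 0, 1]] ![![6, 0, 1, 1, 0], ![0, 6, 0, 1, 1], ![1, 0, 6, 0, 1], ![1, 1, 0, 6, 0], ![0, 1, 1, 0, 6]])
    (by decide +kernel)
    ![Sum.inl 0, Sum.inl 1, Sum.inl 2, Sum.inl 3, Sum.inl 4]
    ![Sum.inl 0, Sum.inl 2, Sum.inl 3, Sum.inr 3, Sum.inr 4]
    (by decide +kernel)

/-! ### Neighborhoods of cubic vertices -/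

/-- `v` has exactly the three neighbors `a`, `b`, `c`. -/
structure Nbrs {V : Type*} (G : SimpleGraph V) (v a b c : V) : Prop where
  ne₁₂ : a ≠ b
  ne₁₃ : a ≠ c
  ne₂₃ : b ≠ c
  adj_iff : ∀ z, G.Adj v z ↔ z = a ∨ z = b ∨ z = c

theorem Nbrs.rotate {V : Type*} {G : SimpleGraph V} {v a b c : V} (h : Nbrs G v a b c) : Nbrs G v b c a :=
  ⟨h.ne₂₃, h.ne₁₂.symm, h.ne₁₃.symm, fun z => by rw [h.adj_iff]; tauto⟩

theorem Nbrs.swap {V : Type*} {G : SimpleGraph V} {v a b c : V} (h : Nbrs G v a b c) :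
    Nbrs G v a c b :=
  ⟨h.ne₁₃, h.ne₁₂, h.ne₂₃.symm, fun z => by rw [h.adj_iff]; tauto⟩

/-- Collects everything `Nbrs` provides into one forward rule for `grind`, which settles the
incidence questions below. -/
theorem Nbrs.facts {V : Type*} {G : SimpleGraph V} {v a b c : V} (h : Nbrs G v a b c) :
    (G.Adj a v ∧ G.Adj b v ∧ G.Adj c v) ∧ (a ≠ b ∧ a ≠ c ∧ b ≠ c ∧ v ≠ a ∧ v ≠ b ∧ v ≠ c) ∧
      ∀ z, G.Adj v z ↔ z = a ∨ z = b ∨ z = c := by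
  have ha := (h.adj_iff a).2 (by simp)
  have hb := (h.adj_iff b).2 (by simp)
  have hc := (h.adj_iff c).2 (by simp)
  exact ⟨⟨ha.symm, hb.symm, hc.symm⟩, ⟨h.ne₁₂, h.ne₁₃, h.ne₂₃, ha.ne, hb.ne, hc.ne⟩, h.adj_iff⟩

/-! ### Greedy growth and the excess of a dominated set -/

section Sequences

variable {V : Type*} [Fintype V] [DecidableEq V] {G : SimpleGraph V} [DecidableRel G.Adj]

/-- The closed neighborhood as a finite set. -/
def closedNbhdFinset (G : SimpleGraph V) [DecidableRel G.Adj] (v : V) : Finset V :=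
  insert v (G.neighborFinset v)

theorem mem_closedNbhdFinset {v w : V} : w ∈ closedNbhdFinset G v ↔ w = v ∨ G.Adj v w := by
  simp [closedNbhdFinset]

theorem self_mem_closedNbhdFinset (v : V) : v ∈ closedNbhdFinset G v :=
  mem_closedNbhdFinset.2 (Or.inl rfl)

theorem mem_closedNbhdFinset_comm {v w : V} :
    w ∈ closedNbhdFinset G v ↔ v ∈ closedNbhdFinset G w := by
  simp [mem_closedNbhdFinset, eq_comm, G.adj_comm]

/-- `DomSeq G D k`: some closed neighborhood sequence of length `k` dominates exactly `D`. -/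
inductive DomSeq (G : SimpleGraph V) [DecidableRel G.Adj] : Finset V → ℕ → Prop
  | nil : DomSeq G ∅ 0
  | snoc {D : Finset V} {k : ℕ} (v : V) (h : DomSeq G D k) (hv : ¬ closedNbhdFinset G v ⊆ D) :
      DomSeq G (D ∪ closedNbhdFinset G v) (k + 1)

/-- The second conjunct strengthens the induction: a vertex outside `D` is then undominated by every
earlier term. -/
theorem DomSeq.exists_isClosedNbhdSeq {D : Finset V} {k : ℕ} (h : DomSeq G D k) :
    ∃ s : Fin k → V, IsClosedNbhdSeq G s ∧ ∀ i, closedNbhdFinset G (s i) ⊆ D := by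
  induction h with
  | nil => exact ⟨Fin.elim0, fun i => i.elim0, fun i => i.elim0⟩
  | @snoc D k v h hv ih =>
    obtain ⟨s, hs, hD⟩ := ih
    obtain ⟨x, hx⟩ := isClosedNbhdSeq_iff.1 hs
    obtain ⟨y, hy, hyD⟩ := Finset.not_subset.1 hv
    refine ⟨Fin.snoc (α := fun _ => V) s v, isClosedNbhdSeq_iff.2
      ⟨Fin.snoc (α := fun _ => V) x y, fun i => ?_⟩, fun i => ?_⟩
    · induction i using Fin.lastCases with
      | last =>
        refine ⟨?_, fun j hj => ?_⟩
        · simpa [mem_closedNbhd, mem_closedNbhdFinset, or_comm] using hy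
        · induction j using Fin.lastCases with
          | last => exact absurd hj (lt_irrefl _)
          | cast j =>
            intro hm
            apply hyD
            apply hD j
            simpa [mem_closedNbhd, mem_closedNbhdFinset, or_comm] using hm
      | cast i =>
        refine ⟨by simpa using (hx i).1, fun j hj => ?_⟩
        induction j using Fin.lastCases with
        | last => exact absurd hj (by simp [Fin.lt_def])
        | cast j => simpa using (hx i).2 j (by simpa using hj)
    · induction i using Fin.lastCases with
      | last => simp
      | cast i => simpa using (hD i).trans Finset.subset_union_left

/-- Dominated sets are unions of closed neighborhoods. -/
theorem DomSeq.exists_closedNbhdFinset_subset {D : Finset V} {k : ℕ} (h : DomSeq G D k) {d : V}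
    (hd : d ∈ D) : ∃ w ∈ closedNbhdFinset G d, closedNbhdFinset G w ⊆ D := by
  induction h with
  | nil => simp at hd
  | @snoc D k v h hv ih =>
    rcases Finset.mem_union.1 hd with hd | hd
    · obtain ⟨w, hw, hwD⟩ := ih hd
      exact ⟨w, hw, hwD.trans Finset.subset_union_left⟩
    · exact ⟨v, mem_closedNbhdFinset_comm.1 hd, Finset.subset_union_right⟩

/-- Concatenation works because what a term gains beyond the earlier part of `E` also lies outside
`D`. -/
theorem DomSeq.union {D E : Finset V} {k l : ℕ} (hD : DomSeq G D k) (hE : DomSeq G E l)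
    (hDE : Disjoint D E) : DomSeq G (D ∪ E) (k + l) := by
  induction hE with
  | nil => simpa using hD
  | @snoc E l v h hv ih =>
    rw [← Finset.union_assoc, ← add_assoc]
    refine DomSeq.snoc v (ih (hDE.mono_right Finset.subset_union_left)) fun hsub => hv ?_
    intro x hx
    rcases Finset.mem_union.1 (hsub hx) with hx' | hx'
    · exact absurd (Finset.mem_union_right _ hx) (Finset.disjoint_left.1 hDE hx')
    · exact hx'

/-- A connected cubic graph in which no closed neighborhood sequence is longer than half the
order. -/
structure Extremal (G : SimpleGraph V) [DecidableRel G.Adj] : Prop where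
  conn : G.Connected
  cubic : G.IsRegularOfDegree 3
  length_le : ∀ ⦃D k⦄, DomSeq G D k → 2 * k ≤ Fintype.card V

/-- Some closed neighborhood sequence dominates exactly `D ≠ ∅`, and its length is at least
`(|D| - e) / 2`. -/
def Excess (G : SimpleGraph V) [DecidableRel G.Adj] (D : Finset V) (e : ℕ) : Prop :=
  D.Nonempty ∧ ∃ k, DomSeq G D k ∧ D.card ≤ 2 * k + e

theorem card_closedNbhdFinset (hG : G.IsRegularOfDegree 3) (v : V) :
    (closedNbhdFinset G v).card = 4 := by
  rw [closedNbhdFinset, Finset.card_insert_of_notMem (by simp), card_neighborFinset_eq_degree,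
    hG v]

/-- Some term `w` dominates `d` with N[w] inside `D`. If `w ≠ d`, two of the four elements of N[d],
namely `d` and `w`, are already dominated; if `w = d`, all four are. -/
theorem DomSeq.card_sdiff_le_two (hG : G.IsRegularOfDegree 3) {D : Finset V} {k : ℕ}
    (h : DomSeq G D k) {d : V} (hd : d ∈ D) : (closedNbhdFinset G d \ D).card ≤ 2 := by
  obtain ⟨w, hw, hwD⟩ := h.exists_closedNbhdFinset_subset hd
  by_cases hdw : w = d
  · subst hdw
    simp [Finset.sdiff_eq_empty_iff_subset.2 hwD]
  have hsub : closedNbhdFinset G d \ D ⊆ closedNbhdFinset G d \ {w, d} := by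
    apply Finset.sdiff_subset_sdiff le_rfl
    intro x hx
    rcases Finset.mem_insert.1 hx with rfl | hx
    · exact hwD (self_mem_closedNbhdFinset _)
    · rwa [Finset.mem_singleton.1 hx]
  refine (Finset.card_le_card hsub).trans ?_
  rw [Finset.card_sdiff_of_subset, card_closedNbhdFinset hG, Finset.card_pair hdw]
  intro x hx
  rcases Finset.mem_insert.1 hx with rfl | hx
  · exact hw
  · rw [Finset.mem_singleton.1 hx]
    exact self_mem_closedNbhdFinset _

/-- A nonempty set closed under taking neighbors is everything, by connectedness. -/
theorem exists_boundary (hG : G.Connected) {D : Finset V} (hD : D.Nonempty)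
    (hD' : D ≠ Finset.univ) : ∃ d ∈ D, ¬ closedNbhdFinset G d ⊆ D := by
  by_contra! h
  apply hD'
  obtain ⟨d, hd⟩ := hD
  refine Finset.eq_univ_iff_forall.2 fun x => ?_
  obtain ⟨p⟩ := hG.preconnected d x
  induction p with
  | nil => exact hd
  | cons hadj p ih => exact ih (h _ hd (mem_closedNbhdFinset.2 (Or.inr hadj)))

theorem card_compl_union_lt {D E : Finset V} (h : ¬ E ⊆ D) : (D ∪ E)ᶜ.card < Dᶜ.card := by
  apply Finset.card_lt_card
  rw [Finset.compl_ssubset_compl]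
  exact ⟨Finset.subset_union_left, fun h' => h (Finset.subset_union_right.trans h')⟩

theorem card_union_closedNbhdFinset (D : Finset V) (v : V) :
    (D ∪ closedNbhdFinset G v).card = D.card + (closedNbhdFinset G v \ D).card := by
  rw [← Finset.union_sdiff_self_eq_union, Finset.card_union_of_disjoint Finset.disjoint_sdiff]

theorem Excess.step (hG : G.IsRegularOfDegree 3) {D : Finset V} {e : ℕ} (h : Excess G D e)
    {d : V} (hd : d ∈ D) : Excess G (D ∪ closedNbhdFinset G d) e := by
  obtain ⟨hne, k, hk, hle⟩ := h
  by_cases hsub : closedNbhdFinset G d ⊆ D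
  · rw [Finset.union_eq_left.2 hsub]
    exact ⟨hne, k, hk, hle⟩
  · refine ⟨hne.mono Finset.subset_union_left, k + 1, hk.snoc d hsub, ?_⟩
    have := hk.card_sdiff_le_two hG hd
    rw [card_union_closedNbhdFinset]
    omega

/-- One more term for one more vertex: 2k grows by 2 and |D| only by 1. -/
theorem Excess.gain {D : Finset V} {e : ℕ} (h : Excess G D (e + 1)) {v : V}
    (hv : (closedNbhdFinset G v \ D).card = 1) : Excess G (D ∪ closedNbhdFinset G v) e := by
  obtain ⟨hne, k, hk, hle⟩ := h
  refine ⟨hne.mono Finset.subset_union_left, k + 1, hk.snoc v fun hsub => ?_, ?_⟩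
  · rw [Finset.sdiff_eq_empty_iff_subset.2 hsub] at hv
    simp at hv
  · rw [card_union_closedNbhdFinset]
    omega

/-- Always continue with a dominated vertex that still has an undominated neighbor: each such term
uses up at most two vertices, so at least (n - |D|)/2 terms follow. -/
theorem DomSeq.exists_completion (hc : G.Connected) (h3 : G.IsRegularOfDegree 3)
    {D : Finset V} {k : ℕ} (h : DomSeq G D k) (hD : D.Nonempty) :
    ∃ l, DomSeq G Finset.univ l ∧ Fintype.card V + 2 * k ≤ 2 * l + D.card := by
  induction hn : Dᶜ.card using Nat.strong_induction_on generalizing D k with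
  | _ n ih =>
    by_cases hu : D = Finset.univ
    · subst hu
      refine ⟨k, h, ?_⟩
      rw [Finset.card_univ]
      omega
    · obtain ⟨d, hd, hsub⟩ := exists_boundary hc hD hu
      obtain ⟨l, hl, hle⟩ := ih _ (hn ▸ card_compl_union_lt hsub) (h.snoc d hsub)
        (hD.mono Finset.subset_union_left) rfl
      refine ⟨l, hl, ?_⟩
      have := h.card_sdiff_le_two h3 hd
      rw [card_union_closedNbhdFinset] at hle
      omega

theorem Extremal.two_mul_le (hG : Extremal G) {D : Finset V} {k : ℕ} (h : DomSeq G D k)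
    (hD : D.Nonempty) : 2 * k ≤ D.card := by
  obtain ⟨l, hl, hle⟩ := h.exists_completion hG.conn hG.cubic hD
  have := hG.length_le hl
  omega

/-- Such a gain would make the excess negative, against `Extremal.two_mul_le`. The vertex `v` itself
need not be dominated. -/
theorem Extremal.card_sdiff_ne_one (hG : Extremal G) {D : Finset V} (h : Excess G D 0) (v : V) :
    (closedNbhdFinset G v \ D).card ≠ 1 := by
  intro hv
  obtain ⟨hne, k, hk, hle⟩ := h
  have hsub : ¬ closedNbhdFinset G v ⊆ D := fun hsub => by
    rw [Finset.sdiff_eq_empty_iff_subset.2 hsub] at hv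
    simp at hv
  have h1 := hG.two_mul_le (hk.snoc v hsub) (hne.mono Finset.subset_union_left)
  rw [card_union_closedNbhdFinset] at h1
  omega

/-- A set dominated without excess leaves a pair of adjacent twins undominated. -/
theorem Extremal.exists_twins (hG : Extremal G) {D : Finset V} (h : Excess G D 0)
    (hD : D ≠ Finset.univ) :
    ∃ x y, x ∉ D ∧ y ∉ D ∧ x ≠ y ∧ closedNbhdFinset G x = closedNbhdFinset G y := by
  induction hn : Dᶜ.card using Nat.strong_induction_on generalizing D with
  | _ n ih =>
    subst hn
    have hpos : Dᶜ.card ≠ 0 := by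
      rw [Finset.card_ne_zero, Finset.nonempty_iff_ne_empty, Ne, Finset.compl_eq_empty_iff]
      exact hD
    obtain ⟨d, hd, hsub⟩ := exists_boundary hG.conn h.1 hD
    by_cases hlast : D ∪ closedNbhdFinset G d = Finset.univ
    · have hle := h.2.choose_spec.1.card_sdiff_le_two hG.cubic hd
      have hcompl : closedNbhdFinset G d \ D = Dᶜ := by
        ext x
        have := Finset.mem_univ x
        rw [← hlast, Finset.mem_union] at this
        simp only [Finset.mem_sdiff, Finset.mem_compl]
        tauto
      have hne := hG.card_sdiff_ne_one h d
      rw [hcompl] at hle hne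
      -- The last greedy step leaves at most two vertices missing, not one by extremality, and not
      -- none.
      obtain ⟨x, y, hxy, hU⟩ := Finset.card_eq_two.1 (show Dᶜ.card = 2 by omega)
      have hmem : ∀ z, z ∉ D ↔ z = x ∨ z = y := fun z => by
        rw [← Finset.mem_compl, hU]; simp
      refine ⟨x, y, (hmem x).2 (Or.inl rfl), (hmem y).2 (Or.inr rfl), hxy, ?_⟩
      ext z
      -- Applied to every vertex `z`: it dominates both or neither of the two missing vertices.
      have key := hG.card_sdiff_ne_one h z
      have hz : ∀ w, w ∈ closedNbhdFinset G z \ D ↔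
          w ∈ closedNbhdFinset G z ∧ (w = x ∨ w = y) := fun w => by
        rw [Finset.mem_sdiff, hmem]
      rw [mem_closedNbhdFinset_comm, mem_closedNbhdFinset_comm (v := y)]
      constructor
      · intro hx
        by_contra hy
        refine key (Finset.card_eq_one.2 ⟨x, ?_⟩)
        ext w
        rw [hz, Finset.mem_singleton]
        constructor
        · rintro ⟨hw, rfl | rfl⟩
          · rfl
          · exact absurd hw hy
        · rintro rfl
          exact ⟨hx, Or.inl rfl⟩
      · intro hy
        by_contra hx
        refine key (Finset.card_eq_one.2 ⟨y, ?_⟩)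
        ext w
        rw [hz, Finset.mem_singleton]
        constructor
        · rintro ⟨hw, rfl | rfl⟩
          · exact absurd hw hx
          · rfl
        · rintro rfl
          exact ⟨hy, Or.inr rfl⟩
    · obtain ⟨x, y, hx, hy, hxy⟩ := ih _ (card_compl_union_lt hsub) (h.step hG.cubic hd) hlast rfl
      exact ⟨x, y, fun hx' => hx (Finset.mem_union_left _ hx'),
        fun hy' => hy (Finset.mem_union_left _ hy'), hxy⟩

theorem Nbrs.mem_iff {v a b c : V} (h : Nbrs G v a b c) {z : V} :
    z ∈ closedNbhdFinset G v ↔ z = v ∨ z = a ∨ z = b ∨ z = c := by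
  rw [mem_closedNbhdFinset, h.adj_iff]

theorem exists_nbrs (hG : G.IsRegularOfDegree 3) (v : V) : ∃ a b c, Nbrs G v a b c := by
  have h : (G.neighborFinset v).card = 3 := by rw [card_neighborFinset_eq_degree, hG v]
  obtain ⟨a, b, c, hab, hac, hbc, h⟩ := Finset.card_eq_three.1 h
  refine ⟨a, b, c, hab, hac, hbc, fun z => ?_⟩
  rw [← mem_neighborFinset, h]
  simp

theorem exists_nbrs_of_adj (hG : G.IsRegularOfDegree 3) {v a : V} (ha : G.Adj v a) :
    ∃ b c, Nbrs G v a b c := by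
  obtain ⟨x, y, z, h⟩ := exists_nbrs hG v
  rcases (h.adj_iff a).1 ha with rfl | rfl | rfl
  · exact ⟨_, _, h⟩
  · exact ⟨_, _, h.rotate⟩
  · exact ⟨_, _, h.rotate.rotate⟩

theorem exists_nbrs_of_adj₂ (hG : G.IsRegularOfDegree 3) {v a b : V} (ha : G.Adj v a)
    (hb : G.Adj v b) (hab : a ≠ b) : ∃ c, Nbrs G v a b c := by
  obtain ⟨x, y, h⟩ := exists_nbrs_of_adj hG ha
  rcases (h.adj_iff b).1 hb with rfl | rfl | rfl
  · exact absurd rfl hab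
  · exact ⟨_, h⟩
  · exact ⟨_, h.swap⟩

theorem exists_nbrs_of_adj₃ (hG : G.IsRegularOfDegree 3) {v a b c : V} (ha : G.Adj v a)
    (hb : G.Adj v b) (hc : G.Adj v c) (hab : a ≠ b) (hac : a ≠ c) (hbc : b ≠ c) :
    Nbrs G v a b c := by
  obtain ⟨x, h⟩ := exists_nbrs_of_adj₂ hG ha hb hab
  rcases (h.adj_iff c).1 hc with rfl | rfl | rfl
  · exact absurd rfl hac
  · exact absurd rfl hbc
  · exact h

theorem Excess.of_nbrs (hG : G.IsRegularOfDegree 3) {v a b c : V} (h : Nbrs G v a b c) :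
    Excess G {v, a, b, c} 2 := by
  have hD : ({v, a, b, c} : Finset V) = ∅ ∪ closedNbhdFinset G v := by
    ext z
    rw [Finset.mem_union, h.mem_iff]
    simp
  rw [hD]
  refine ⟨⟨v, by simp [h.mem_iff]⟩, 1, DomSeq.nil.snoc v fun hsub => ?_, ?_⟩
  · simpa using hsub (self_mem_closedNbhdFinset v)
  · rw [Finset.empty_union, card_closedNbhdFinset hG]

/-- Only `a` and `b` can be new in N[v], so the step pays for itself. -/
theorem Excess.insert₂ (hG : G.IsRegularOfDegree 3) {D : Finset V} {e : ℕ} (h : Excess G D e)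
    {v a b c : V} (hv : v ∈ D) (hn : Nbrs G v a b c) (hc : c ∈ D) :
    Excess G (insert a (insert b D)) e := by
  have hD : insert a (insert b D) = D ∪ closedNbhdFinset G v := by
    ext z
    rw [Finset.mem_union, hn.mem_iff]
    simp only [Finset.mem_insert]
    constructor
    · tauto
    · rintro (hz | rfl | hz | hz | rfl) <;> tauto
  rw [hD]
  exact h.step hG hv

theorem sdiff_eq_singleton {D : Finset V} {v w : V} (hv : v ∈ D) (hvw : G.Adj v w) (hw : w ∉ D)
    (hz : ∀ z, G.Adj v z → z = w ∨ z ∈ D) : closedNbhdFinset G v \ D = {w} := by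
  ext z
  rw [Finset.mem_sdiff, mem_closedNbhdFinset, Finset.mem_singleton]
  constructor
  · rintro ⟨rfl | h, hzD⟩
    · exact absurd hv hzD
    · exact (hz z h).resolve_right hzD
  · rintro rfl
    exact ⟨Or.inr hvw, hw⟩

theorem Excess.insert₁ {D : Finset V} {e : ℕ} (h : Excess G D (e + 1)) {v w : V} (hv : v ∈ D)
    (hvw : G.Adj v w) (hw : w ∉ D) (hz : ∀ z, G.Adj v z → z = w ∨ z ∈ D) :
    Excess G (insert w D) e := by
  have h1 := sdiff_eq_singleton hv hvw hw hz
  have hD : insert w D = D ∪ closedNbhdFinset G v := by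
    rw [← Finset.union_sdiff_self_eq_union, h1, Finset.union_comm, Finset.insert_eq]
  rw [hD]
  exact h.gain (by rw [h1, Finset.card_singleton])

theorem Extremal.not_excess (hG : Extremal G) {D : Finset V} (h : Excess G D 0) {v w : V}
    (hv : v ∈ D) (hvw : G.Adj v w) (hw : w ∉ D) (hz : ∀ z, G.Adj v z → z = w ∨ z ∈ D) : False :=
  hG.card_sdiff_ne_one h v (by rw [sdiff_eq_singleton hv hvw hw hz, Finset.card_singleton])

/-- Adjacent twins whose two common neighbors have no further common neighbor are dominated
only after both common neighbors are. -/
theorem Extremal.mem_of_twins (hG : Extremal G) {D : Finset V} (h : Excess G D 0)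
    {x y a b a' b' : V} (hx : Nbrs G x y a b) (hy : Nbrs G y x a b) (ha : Nbrs G a x y a')
    (hb : Nbrs G b x y b') (hab : a' ≠ b') (hxD : x ∉ D) (hyD : y ∉ D) : a ∈ D ∧ b ∈ D := by
  -- If `a` is dominated but `b` is not, then taking `a` dominates `x` and `y` and leaves `b` as the
  -- only new vertex of `x`. The case `a' = b` is excluded because `a` would gain three vertices.
  have enter : ∀ {D : Finset V}, Excess G D 0 → x ∉ D → y ∉ D → ∀ {a b a' : V},
      Nbrs G x y a b → Nbrs G a x y a' → a ∈ D → b ∈ D := by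
    intro D h hxD hyD a b a' hx ha haD
    by_contra hbD
    have hna : b ∉ closedNbhdFinset G a := by
      rw [ha.mem_iff]
      have := hx.ne₂₃
      have := (hx.adj_iff b).2 (by simp)
      have := this.ne
      have := hx.ne₁₃
      rintro (rfl | rfl | rfl | rfl)
      · contradiction
      · contradiction
      · contradiction
      · have h1 := h.2.choose_spec.1.card_sdiff_le_two hG.cubic haD
        have h2 : ({x, y, b} : Finset V) ⊆ closedNbhdFinset G a \ D := by
          intro z hz
          simp only [Finset.mem_insert, Finset.mem_singleton] at hz
          rw [Finset.mem_sdiff, ha.mem_iff]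
          rcases hz with rfl | rfl | rfl <;> tauto
        have h3 := Finset.card_le_card h2
        rw [Finset.card_eq_three.2 ⟨x, y, b, ha.ne₁₂, ha.ne₁₃, ha.ne₂₃, rfl⟩] at h3
        omega
    refine hG.not_excess (h.step hG.cubic haD) (v := x) (w := b) ?_ ?_ ?_ ?_
    · simp [ha.mem_iff]
    · simp [hx.adj_iff]
    · simp [hna, hbD]
    · intro z hz
      rw [Finset.mem_union, ha.mem_iff]
      rcases (hx.adj_iff z).1 hz with rfl | rfl | rfl <;> tauto
  induction hn : Dᶜ.card using Nat.strong_induction_on generalizing D with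
  | _ n ih =>
    subst hn
    by_cases haD : a ∈ D
    · exact ⟨haD, enter h hxD hyD hx ha haD⟩
    by_cases hbD : b ∈ D
    · exact ⟨enter h hxD hyD hx.swap hb hbD, hbD⟩
    exfalso
    obtain ⟨d, hd, hsub⟩ := exists_boundary hG.conn h.1 (fun h => hxD (h ▸ Finset.mem_univ _))
    have hout : ∀ z w, Nbrs G z w a b → z ∉ D → w ∉ D → z ∉ D ∪ closedNbhdFinset G d := by
      intro z w hz hzD hwD hmem
      rcases Finset.mem_union.1 hmem with hm | hm
      · exact hzD hm
      · rcases hz.mem_iff.1 (mem_closedNbhdFinset_comm.1 hm) with rfl | rfl | rfl | rfl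
        all_goals contradiction
    -- By induction one step at `d` dominates `a` and `b` simultaneously. This forces `d = a'` and
    -- `d = b'`, although these differ.
    obtain ⟨ha', hb'⟩ := ih _ (card_compl_union_lt hsub) (h.step hG.cubic hd)
      (hout x y hx hxD hyD) (hout y x hy hyD hxD) rfl
    have ha' := ha.mem_iff.1 (mem_closedNbhdFinset_comm.1
      ((Finset.mem_union.1 ha').resolve_left haD))
    have hb' := hb.mem_iff.1 (mem_closedNbhdFinset_comm.1
      ((Finset.mem_union.1 hb').resolve_left hbD))
    rcases ha' with rfl | rfl | rfl | rfl
    · contradiction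
    · contradiction
    · contradiction
    · rcases hb' with rfl | rfl | rfl | rfl <;> contradiction

/-- A set dominated without excess meets every set that is dominated without excess and can be
left through a single vertex. -/
theorem Extremal.not_disjoint (hG : Extremal G) {D F : Finset V} (h : Excess G D 0)
    (hF : Excess G F 0) {q : V} (hq : ∀ u ∈ F, ∀ z ∉ F, G.Adj u z → u = q) : ¬ Disjoint D F := by
  intro hDF
  induction hn : Dᶜ.card using Nat.strong_induction_on generalizing D with
  | _ n ih =>
    subst hn
    have hDu : D ≠ Finset.univ := by
      rintro rfl
      obtain ⟨u, hu⟩ := hF.1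
      exact Finset.disjoint_left.1 hDF (Finset.mem_univ u) hu
    obtain ⟨d, hd, hsub⟩ := exists_boundary hG.conn h.1 hDu
    have hdF := Finset.disjoint_left.1 hDF hd
    by_cases hdis : Disjoint (D ∪ closedNbhdFinset G d) F
    · exact ih _ (card_compl_union_lt hsub) (h.step hG.cubic hd) hdis rfl
    obtain ⟨u, hu, huF⟩ := Finset.not_disjoint_iff.1 hdis
    have honly : ∀ u ∈ closedNbhdFinset G d, u ∈ F → u = q := by
      intro u hu huF
      rcases mem_closedNbhdFinset.1 hu with rfl | hu
      · contradiction
      · exact hq u huF d hdF hu.symm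
    have hud : u ∈ closedNbhdFinset G d :=
      (Finset.mem_union.1 hu).resolve_left (Finset.disjoint_right.1 hDF huF)
    obtain rfl := honly u hud huF
    obtain ⟨_, k, hk, hle⟩ := h
    obtain ⟨_, l, hl, hle'⟩ := hF
    -- At the first contact, N[d] meets `F` in `q` alone. It has exactly two vertices outside `D`,
    -- hence exactly one outside `D ∪ F`, which also has excess 0.
    have hunion : Excess G (D ∪ F) 0 := by
      refine ⟨⟨d, Finset.mem_union_left _ hd⟩, k + l, hk.union hl hDF, ?_⟩
      rw [Finset.card_union_of_disjoint hDF]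
      omega
    have h1 := hG.card_sdiff_ne_one ⟨⟨d, hd⟩, k, hk, hle⟩ d
    have h2 := hk.card_sdiff_le_two hG.cubic hd
    have h3 := hG.card_sdiff_ne_one hunion d
    have h4 : closedNbhdFinset G d \ (D ∪ F) = (closedNbhdFinset G d \ D).erase u := by
      ext z
      simp only [Finset.mem_sdiff, Finset.mem_union, Finset.mem_erase]
      constructor
      · rintro ⟨hz, hz'⟩
        refine ⟨?_, hz, fun h => hz' (Or.inl h)⟩
        rintro rfl
        exact hz' (Or.inr huF)
      · rintro ⟨hzu, hz, hzD⟩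
        exact ⟨hz, fun h => h.elim hzD fun h => hzu (honly z hz h)⟩
    have h5 : u ∈ closedNbhdFinset G d \ D :=
      Finset.mem_sdiff.2 ⟨hud, Finset.disjoint_right.1 hDF huF⟩
    rw [h4, Finset.card_erase_of_mem h5] at h3
    have := Finset.card_pos.2 ⟨u, h5⟩
    omega

end Sequences

/-! ### Recognizing a cubic graph from an embedded copy -/

section Isomorphism

variable {V W : Type*} [Fintype V] [Fintype W] {G : SimpleGraph V} [DecidableRel G.Adj]

/-- An injective homomorphism of a cubic graph into a connected cubic graph is an isomorphism. -/
theorem nonempty_iso_of_injective_hom (hc : G.Connected) (h3 : G.IsRegularOfDegree 3)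
    (H : SimpleGraph W) [DecidableRel H.Adj] [Nonempty W] (hH : ∀ u, H.degree u = 3)
    (f : W → V) (hf : Function.Injective f) (hadj : ∀ u v, H.Adj u v → G.Adj (f u) (f v)) :
    Nonempty (G ≃g H) := by
  classical
  -- Both degrees are 3, so the image of a neighborhood fills the neighborhood; the range is thus
  -- closed under adjacency.
  have himage : ∀ u, G.neighborFinset (f u) = (H.neighborFinset u).image f := by
    intro u
    symm
    apply Finset.eq_of_subset_of_card_le
    · intro z hz
      obtain ⟨v, hv, rfl⟩ := Finset.mem_image.1 hz
      rw [mem_neighborFinset] at hv ⊢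
      exact hadj _ _ hv
    · rw [Finset.card_image_of_injective _ hf, card_neighborFinset_eq_degree,
        card_neighborFinset_eq_degree, h3, hH]
  have hsurj : Function.Surjective f := by
    intro z
    obtain ⟨u⟩ := ‹Nonempty W›
    obtain ⟨p⟩ := hc.preconnected (f u) z
    suffices ∀ {x y : V} (p : G.Walk x y), (∃ u, f u = x) → ∃ u, f u = y from this p ⟨u, rfl⟩
    intro x y p
    induction p with
    | nil => exact id
    | cons h p ih =>
      rintro ⟨u, rfl⟩
      apply ih
      rw [← mem_neighborFinset, himage, Finset.mem_image] at h
      obtain ⟨v, -, hv⟩ := h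
      exact ⟨v, hv⟩
  refine ⟨(RelIso.symm ⟨Equiv.ofBijective f ⟨hf, hsurj⟩, ?_⟩ : G ≃g H)⟩
  intro u v
  refine ⟨fun h => ?_, hadj u v⟩
  change G.Adj (f u) (f v) at h
  rw [← mem_neighborFinset, himage, Finset.mem_image] at h
  obtain ⟨w, hw, hwv⟩ := h
  rw [← hf hwv]
  exact (mem_neighborFinset ..).1 hw

/-- A variant of `nonempty_iso_of_injective_hom` with explicit lists of vertices and edges. -/
theorem nonempty_iso_of_lists (hc : G.Connected) (h3 : G.IsRegularOfDegree 3)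
    (H : SimpleGraph W) [DecidableRel H.Adj] [Nonempty W] (hH : ∀ u, H.degree u = 3)
    (vs : List W) (hvs : ∀ u, ∃ x ∈ vs, x = u) (es : List (W × W))
    (hes : ∀ u v, H.Adj u v → ∃ e ∈ es, e = (u, v) ∨ e = (v, u)) (f : W → V) (hf : (vs.map f).Nodup)
    (hadj : ∀ e ∈ es, G.Adj (f e.1) (f e.2)) : Nonempty (G ≃g H) := by
  have hvs' : ∀ u, u ∈ vs := fun u => by
    obtain ⟨x, hx, rfl⟩ := hvs u
    exact hx
  refine nonempty_iso_of_injective_hom hc h3 H hH f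
    (fun u v => List.inj_on_of_nodup_map hf (hvs' u) (hvs' v)) fun u v h => ?_
  obtain ⟨e, he, rfl | rfl⟩ := hes u v h
  · exact hadj _ he
  · exact (hadj _ he).symm

end Isomorphism

/-! ### Recognition of each of the eight graphs -/

section TargetGraphs

variable {V : Type*} [Fintype V] {G : SimpleGraph V} [DecidableRel G.Adj]

theorem nonempty_iso_K33 (hc : G.Connected) (h3 : G.IsRegularOfDegree 3)
    {p q r s t u : V}
    (hnd : [p, q, r, s, t, u].Nodup)
    (hadj : G.Adj p s ∧ G.Adj p t ∧ G.Adj p u ∧ G.Adj q s ∧ G.Adj q t ∧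
      G.Adj q u ∧ G.Adj r s ∧ G.Adj r t ∧ G.Adj r u) :
    Nonempty (G ≃g K33) := by
  refine nonempty_iso_of_lists hc h3 K33 (by decide +kernel)
    [.inl 0, .inl 1, .inl 2, .inr 0, .inr 1, .inr 2] (by decide +kernel)
    [(.inl 0, .inr 0), (.inl 0, .inr 1), (.inl 0, .inr 2), (.inl 1, .inr 0), (.inl 1, .inr 1),
     (.inl 1, .inr 2), (.inl 2, .inr 0), (.inl 2, .inr 1), (.inl 2, .inr 2)]
    (by decide +kernel)
    (Sum.elim ![p, q, r] ![s, t, u]) hnd ?_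
  simpa using hadj

theorem nonempty_iso_Y2 (hc : G.Connected) (h3 : G.IsRegularOfDegree 3)
    {a b x y p c d z w q : V}
    (hnd : [a, b, x, y, p, c, d, z, w, q].Nodup)
    (hadj : G.Adj a x ∧ G.Adj a y ∧ G.Adj a p ∧ G.Adj b x ∧ G.Adj b y ∧
      G.Adj b p ∧ G.Adj x y ∧ G.Adj p q ∧ G.Adj c z ∧ G.Adj c w ∧
      G.Adj c q ∧ G.Adj d z ∧ G.Adj d w ∧ G.Adj d q ∧ G.Adj z w) :
    Nonempty (G ≃g Y2) := by
  refine nonempty_iso_of_lists hc h3 Y2 (by decide +kernel)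
    [.inl (.inl 0), .inl (.inl 1), .inl (.inr 0), .inl (.inr 1), .inl (.inr 2), .inr (.inl 0),
     .inr (.inl 1), .inr (.inr 0), .inr (.inr 1), .inr (.inr 2)] (by decide +kernel)
    [(.inl (.inl 0), .inl (.inr 0)), (.inl (.inl 0), .inl (.inr 1)),
     (.inl (.inl 0), .inl (.inr 2)), (.inl (.inl 1), .inl (.inr 0)),
     (.inl (.inl 1), .inl (.inr 1)), (.inl (.inl 1), .inl (.inr 2)),
     (.inl (.inr 0), .inl (.inr 1)), (.inl (.inr 2), .inr (.inr 2)),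
     (.inr (.inl 0), .inr (.inr 0)), (.inr (.inl 0), .inr (.inr 1)),
     (.inr (.inl 0), .inr (.inr 2)), (.inr (.inl 1), .inr (.inr 0)),
     (.inr (.inl 1), .inr (.inr 1)), (.inr (.inl 1), .inr (.inr 2)),
     (.inr (.inr 0), .inr (.inr 1))]
    (by decide +kernel)
    (Sum.elim (Sum.elim ![a, b] ![x, y, p]) (Sum.elim ![c, d] ![z, w, q])) hnd ?_
  simpa using hadj

set_option synthInstance.maxSize 1000 in
theorem nonempty_iso_Y3 (hc : G.Connected) (h3 : G.IsRegularOfDegree 3)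
    {r a₁ b₁ x₁ y₁ p₁ a₂ b₂ x₂ y₂ p₂ a₃ b₃ x₃ y₃ p₃ : V}
    (hnd : [r, a₁, b₁, x₁, y₁, p₁, a₂, b₂, x₂, y₂, p₂, a₃, b₃, x₃, y₃, p₃].Nodup)
    (hadj : G.Adj r p₁ ∧ G.Adj r p₂ ∧ G.Adj r p₃ ∧ G.Adj a₁ x₁ ∧ G.Adj a₁ y₁ ∧
      G.Adj a₁ p₁ ∧ G.Adj b₁ x₁ ∧ G.Adj b₁ y₁ ∧ G.Adj b₁ p₁ ∧ G.Adj x₁ y₁ ∧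
      G.Adj a₂ x₂ ∧ G.Adj a₂ y₂ ∧ G.Adj a₂ p₂ ∧ G.Adj b₂ x₂ ∧ G.Adj b₂ y₂ ∧
      G.Adj b₂ p₂ ∧ G.Adj x₂ y₂ ∧ G.Adj a₃ x₃ ∧ G.Adj a₃ y₃ ∧ G.Adj a₃ p₃ ∧
      G.Adj b₃ x₃ ∧ G.Adj b₃ y₃ ∧ G.Adj b₃ p₃ ∧ G.Adj x₃ y₃) :
    Nonempty (G ≃g Y3) := by
  refine nonempty_iso_of_lists hc h3 Y3 (by decide +kernel)
    [.inl (), .inr (0, .inl 0), .inr (0, .inl 1), .inr (0, .inr 0), .inr (0, .inr 1),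
     .inr (0, .inr 2), .inr (1, .inl 0), .inr (1, .inl 1), .inr (1, .inr 0), .inr (1, .inr 1),
     .inr (1, .inr 2), .inr (2, .inl 0), .inr (2, .inl 1), .inr (2, .inr 0), .inr (2, .inr 1),
     .inr (2, .inr 2)] (by decide +kernel)
    [(.inl (), .inr (0, .inr 2)), (.inl (), .inr (1, .inr 2)), (.inl (), .inr (2, .inr 2)),
     (.inr (0, .inl 0), .inr (0, .inr 0)), (.inr (0, .inl 0), .inr (0, .inr 1)),
     (.inr (0, .inl 0), .inr (0, .inr 2)), (.inr (0, .inl 1), .inr (0, .inr 0)),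
     (.inr (0, .inl 1), .inr (0, .inr 1)), (.inr (0, .inl 1), .inr (0, .inr 2)),
     (.inr (0, .inr 0), .inr (0, .inr 1)), (.inr (1, .inl 0), .inr (1, .inr 0)),
     (.inr (1, .inl 0), .inr (1, .inr 1)), (.inr (1, .inl 0), .inr (1, .inr 2)),
     (.inr (1, .inl 1), .inr (1, .inr 0)), (.inr (1, .inl 1), .inr (1, .inr 1)),
     (.inr (1, .inl 1), .inr (1, .inr 2)), (.inr (1, .inr 0), .inr (1, .inr 1)),
     (.inr (2, .inl 0), .inr (2, .inr 0)), (.inr (2, .inl 0), .inr (2, .inr 1)),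
     (.inr (2, .inl 0), .inr (2, .inr 2)), (.inr (2, .inl 1), .inr (2, .inr 0)),
     (.inr (2, .inl 1), .inr (2, .inr 1)), (.inr (2, .inl 1), .inr (2, .inr 2)),
     (.inr (2, .inr 0), .inr (2, .inr 1))]
    (by decide +kernel)
    (Sum.elim (fun _ => r) (fun u => ![Sum.elim ![a₁, b₁] ![x₁, y₁, p₁], Sum.elim ![a₂, b₂] ![x₂, y₂, p₂], Sum.elim ![a₃, b₃] ![x₃, y₃, p₃]] u.1 u.2)) hnd ?_
  simpa using hadj

theorem nonempty_iso_NYY (hc : G.Connected) (h3 : G.IsRegularOfDegree 3)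
    {a b x y c d z w : V}
    (hnd : [a, b, x, y, c, d, z, w].Nodup)
    (hadj : G.Adj a x ∧ G.Adj a y ∧ G.Adj a c ∧ G.Adj b x ∧ G.Adj b y ∧
      G.Adj b d ∧ G.Adj x y ∧ G.Adj c z ∧ G.Adj c w ∧ G.Adj d z ∧
      G.Adj d w ∧ G.Adj z w) :
    Nonempty (G ≃g NYY) := by
  refine nonempty_iso_of_lists hc h3 NYY (by decide +kernel)
    [.inl 0, .inl 1, .inl 2, .inl 3, .inr 0, .inr 1, .inr 2, .inr 3] (by decide +kernel)
    [(.inl 0, .inl 2), (.inl 0, .inl 3), (.inl 0, .inr 0), (.inl 1, .inl 2), (.inl 1, .inl 3),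
     (.inl 1, .inr 1), (.inl 2, .inl 3), (.inr 0, .inr 2), (.inr 0, .inr 3), (.inr 1, .inr 2),
     (.inr 1, .inr 3), (.inr 2, .inr 3)]
    (by decide +kernel)
    (Sum.elim ![a, b, x, y] ![c, d, z, w]) hnd ?_
  simpa using hadj

theorem nonempty_iso_K3boxK2 (hc : G.Connected) (h3 : G.IsRegularOfDegree 3)
    {a b c a' b' c' : V}
    (hnd : [a, b, c, a', b', c'].Nodup)
    (hadj : G.Adj a b ∧ G.Adj a c ∧ G.Adj a a' ∧ G.Adj b c ∧ G.Adj b b' ∧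
      G.Adj c c' ∧ G.Adj a' b' ∧ G.Adj a' c' ∧ G.Adj b' c') :
    Nonempty (G ≃g K3boxK2) := by
  refine nonempty_iso_of_lists hc h3 K3boxK2 (by decide +kernel)
    [(0, 0), (1, 0), (2, 0), (0, 1), (1, 1), (2, 1)] (by decide +kernel)
    [((0, 0), (1, 0)), ((0, 0), (2, 0)), ((0, 0), (0, 1)), ((1, 0), (2, 0)), ((1, 0), (1, 1)),
     ((2, 0), (2, 1)), ((0, 1), (1, 1)), ((0, 1), (2, 1)), ((1, 1), (2, 1))]
    (by decide +kernel)
    (fun u => ![![a, b, c], ![a', b', c']] u.2 u.1) hnd ?_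
  simpa using hadj

theorem nonempty_iso_Q3 (hc : G.Connected) (h3 : G.IsRegularOfDegree 3)
    {a b c d a' b' c' d' : V}
    (hnd : [a, b, c, d, a', b', c', d'].Nodup)
    (hadj : G.Adj a b ∧ G.Adj a d ∧ G.Adj a a' ∧ G.Adj b c ∧ G.Adj b b' ∧
      G.Adj c d ∧ G.Adj c c' ∧ G.Adj d d' ∧ G.Adj a' b' ∧ G.Adj a' d' ∧
      G.Adj b' c' ∧ G.Adj c' d') :
    Nonempty (G ≃g Q3) := by
  refine nonempty_iso_of_lists hc h3 Q3 (by decide +kernel)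
    [((0, 0), 0), ((0, 1), 0), ((1, 1), 0), ((1, 0), 0), ((0, 0), 1), ((0, 1), 1), ((1, 1), 1),
     ((1, 0), 1)] (by decide +kernel)
    [(((0, 0), 0), ((0, 1), 0)), (((0, 0), 0), ((1, 0), 0)), (((0, 0), 0), ((0, 0), 1)),
     (((0, 1), 0), ((1, 1), 0)), (((0, 1), 0), ((0, 1), 1)), (((1, 1), 0), ((1, 0), 0)),
     (((1, 1), 0), ((1, 1), 1)), (((1, 0), 0), ((1, 0), 1)), (((0, 0), 1), ((0, 1), 1)),
     (((0, 0), 1), ((1, 0), 1)), (((0, 1), 1), ((1, 1), 1)), (((1, 1), 1), ((1, 0), 1))]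
    (by decide +kernel)
    (fun u => ![![![a, b], ![d, c]], ![![a', b'], ![d', c']]] u.2 u.1.1 u.1.2) hnd ?_
  simpa using hadj

theorem nonempty_iso_TQ3 (hc : G.Connected) (h3 : G.IsRegularOfDegree 3)
    {a b c d a' b' c' d' : V}
    (hnd : [a, b, c, d, a', b', c', d'].Nodup)
    (hadj : G.Adj a b ∧ G.Adj a d ∧ G.Adj a a' ∧ G.Adj b c ∧ G.Adj b b' ∧
      G.Adj c d ∧ G.Adj c d' ∧ G.Adj d c' ∧ G.Adj a' b' ∧ G.Adj a' d' ∧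
      G.Adj b' c' ∧ G.Adj c' d') :
    Nonempty (G ≃g TQ3) := by
  refine nonempty_iso_of_lists hc h3 TQ3 (by decide +kernel)
    [.inl 0, .inl 1, .inl 2, .inl 3, .inr 0, .inr 1, .inr 2, .inr 3] (by decide +kernel)
    [(.inl 0, .inl 1), (.inl 0, .inl 3), (.inl 0, .inr 0), (.inl 1, .inl 2), (.inl 1, .inr 1),
     (.inl 2, .inl 3), (.inl 2, .inr 3), (.inl 3, .inr 2), (.inr 0, .inr 1), (.inr 0, .inr 3),
     (.inr 1, .inr 2), (.inr 2, .inr 3)]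
    (by decide +kernel)
    (Sum.elim ![a, b, c, d] ![a', b', c', d']) hnd ?_
  simpa using hadj

theorem nonempty_iso_petersen (hc : G.Connected) (h3 : G.IsRegularOfDegree 3)
    {v₀ v₁ v₂ v₃ v₄ w₀ w₁ w₂ w₃ w₄ : V}
    (hnd : [v₀, v₁, v₂, v₃, v₄, w₀, w₁, w₂, w₃, w₄].Nodup)
    (hadj : G.Adj v₀ v₁ ∧ G.Adj v₀ v₄ ∧ G.Adj v₀ w₀ ∧ G.Adj v₁ v₂ ∧ G.Adj v₁ w₁ ∧
      G.Adj v₂ v₃ ∧ G.Adj v₂ w₂ ∧ G.Adj v₃ v₄ ∧ G.Adj v₃ w₃ ∧ G.Adj v₄ w₄ ∧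
      G.Adj w₀ w₂ ∧ G.Adj w₀ w₃ ∧ G.Adj w₁ w₃ ∧ G.Adj w₁ w₄ ∧ G.Adj w₂ w₄) :
    Nonempty (G ≃g petersen) := by
  refine nonempty_iso_of_lists hc h3 petersen (by decide +kernel)
    [.inl 0, .inl 1, .inl 2, .inl 3, .inl 4, .inr 0, .inr 1, .inr 2, .inr 3, .inr 4] (by decide +kernel)
    [(.inl 0, .inl 1), (.inl 0, .inl 4), (.inl 0, .inr 0), (.inl 1, .inl 2), (.inl 1, .inr 1),
     (.inl 2, .inl 3), (.inl 2, .inr 2), (.inl 3, .inl 4), (.inl 3, .inr 3), (.inl 4, .inr 4),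
     (.inr 0, .inr 2), (.inr 0, .inr 3), (.inr 1, .inr 3), (.inr 1, .inr 4), (.inr 2, .inr 4)]
    (by decide +kernel)
    (Sum.elim ![v₀, v₁, v₂, v₃, v₄] ![w₀, w₁, w₂, w₃, w₄]) hnd ?_
  simpa using hadj

end TargetGraphs

/-! ### No twins, with a triangle -/

section TwinFree

variable {V : Type*} [Fintype V] [DecidableEq V] {G : SimpleGraph V} [DecidableRel G.Adj]

/-- No two vertices have the same closed neighborhood. -/
def TwinFree (G : SimpleGraph V) [DecidableRel G.Adj] : Prop :=
  ∀ x y, closedNbhdFinset G x = closedNbhdFinset G y → x = y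

theorem Extremal.mem_of_twinFree (hG : Extremal G) (ht : TwinFree G) {D : Finset V}
    (h : Excess G D 0) (z : V) : z ∈ D := by
  by_contra hz
  obtain ⟨x, y, -, -, hxy, h⟩ := hG.exists_twins h fun h => hz (h ▸ Finset.mem_univ z)
  exact hxy (ht x y h)

/-- The third neighbors `a'`, `b'`, `c'` are distinct, since equal ones would create twins. After
`a`, the vertices `b` and `c` gain one vertex each, so these six vertices are all of G and `a'`,
`b'`, `c'` have to be adjacent to one another. -/
theorem Extremal.iso_of_triangle (hG : Extremal G) (ht : TwinFree G) {a b c : V}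
    (hab : G.Adj a b) (hac : G.Adj a c) (hbc : G.Adj b c) : Nonempty (G ≃g K3boxK2) := by
  obtain ⟨a', ha⟩ := exists_nbrs_of_adj₂ hG.cubic hab hac hbc.ne
  obtain ⟨b', hb⟩ := exists_nbrs_of_adj₂ hG.cubic hab.symm hbc hac.ne
  obtain ⟨c', hc⟩ := exists_nbrs_of_adj₂ hG.cubic hac.symm hbc.symm hab.ne
  have hab' : a' ≠ b' := by
    rintro rfl
    refine hab.ne (ht a b ?_)
    ext z
    rw [ha.mem_iff, hb.mem_iff]
    tauto
  have hac' : a' ≠ c' := by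
    rintro rfl
    refine hac.ne (ht a c ?_)
    ext z
    rw [ha.mem_iff, hc.mem_iff]
    tauto
  have hbc' : b' ≠ c' := by
    rintro rfl
    refine hbc.ne (ht b c ?_)
    ext z
    rw [hb.mem_iff, hc.mem_iff]
    tauto
  have h1 : Excess G {a, b, c, a'} 2 := .of_nbrs hG.cubic ha
  have h2 : Excess G {b', a, b, c, a'} 1 := by
    refine h1.insert₁ (v := b) ?_ ?_ ?_ ?_ <;>
      (try simp only [Finset.mem_insert, Finset.mem_singleton]) <;> clear h1 <;> grind [→ Nbrs.facts]
  have h3 : Excess G {c', b', a, b, c, a'} 0 := by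
    refine h2.insert₁ (v := c) ?_ ?_ ?_ ?_ <;>
      (try simp only [Finset.mem_insert, Finset.mem_singleton]) <;> clear h1 h2 <;> grind [→ Nbrs.facts]
  have hu := hG.mem_of_twinFree ht h3
  simp only [Finset.mem_insert, Finset.mem_singleton] at hu
  obtain ⟨p, q, ha'⟩ := exists_nbrs_of_adj hG.cubic ha.facts.1.2.2
  obtain ⟨r, s, hb'⟩ := exists_nbrs_of_adj hG.cubic hb.facts.1.2.2
  clear h1 h2 h3 ht
  have hp := hu p
  have hq := hu q
  have hr := hu r
  have hs := hu s
  have hab'' : G.Adj a' b' := by grind [→ Nbrs.facts]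
  have hac'' : G.Adj a' c' := by grind [→ Nbrs.facts]
  have hbc'' : G.Adj b' c' := by grind [→ Nbrs.facts]
  refine nonempty_iso_K3boxK2 hG.conn hG.cubic (a := a) (b := b) (c := c) (a' := a') (b' := b')
    (c' := c') ?_ ?_
  · simp
    grind [→ Nbrs.facts]
  · grind [→ Nbrs.facts]

end TwinFree

/-! ### No twins, no triangle, with a 4-cycle -/

section TriangleFree

variable {V : Type*} [Fintype V] [DecidableEq V] {G : SimpleGraph V} [DecidableRel G.Adj]

/-- The terms `p`, `r`, `t` bring the excess down to 1, and a further single gain exhausts the graph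
with eight vertices. In either case some vertex, `z` or `t'`, then lacks neighbors. -/
theorem Extremal.not_three_common (hG : Extremal G) (ht : TwinFree G) {p q r s t u t' : V}
    (hp : Nbrs G p r s t) (hq : Nbrs G q r s t) (hr : Nbrs G r p q u) (hs : Nbrs G s p q u)
    (hv : Nbrs G t p q t') (hut : u ≠ t') (hrs : ¬ G.Adj r s) (hrt : ¬ G.Adj r t)
    (hst : ¬ G.Adj s t) : False := by
  have h1 : Excess G {p, r, s, t} 2 := .of_nbrs hG.cubic hp
  have h2 : Excess G {q, u, p, r, s, t} 2 := h1.insert₂ hG.cubic (v := r) (by simp) hr.rotate (by simp)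
  have h3 : Excess G {t', q, u, p, r, s, t} 1 := by
    refine h2.insert₁ (v := t) ?_ ?_ ?_ ?_ <;>
      (try simp only [Finset.mem_insert, Finset.mem_singleton]) <;> clear h1 h2 <;>
      grind [→ Nbrs.facts]
  obtain ⟨y, hu⟩ := exists_nbrs_of_adj₂ hG.cubic hr.facts.1.2.2 hs.facts.1.2.2 hp.ne₁₂
  by_cases hy : y = t'
  · subst hy
    obtain ⟨z, hy⟩ := exists_nbrs_of_adj₂ hG.cubic hv.facts.1.2.2 hu.facts.1.2.2 (by grind [→ Nbrs.facts])
    have h4 : Excess G {z, y, q, u, p, r, s, t} 0 := by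
      refine h3.insert₁ (v := y) ?_ ?_ ?_ ?_ <;>
        (try simp only [Finset.mem_insert, Finset.mem_singleton]) <;> clear h1 h2 h3 <;>
        grind [→ Nbrs.facts]
    have hu' := hG.mem_of_twinFree ht h4
    obtain ⟨m, n, hz⟩ := exists_nbrs_of_adj hG.cubic hy.facts.1.2.2
    have key : ∀ m, G.Adj z m → m = y := by
      intro m hm
      have h := hu' m
      simp only [Finset.mem_insert, Finset.mem_singleton] at h
      clear h1 h2 h3 h4 hu' ht
      rcases h with rfl | rfl | rfl | rfl | rfl | rfl | rfl | rfl <;> grind [→ Nbrs.facts]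
    exact hz.ne₁₂ (key m hz.facts.1.2.1.symm).symm
  · have h4 : Excess G {y, t', q, u, p, r, s, t} 0 := by
      refine h3.insert₁ (v := u) ?_ ?_ ?_ ?_ <;>
        (try simp only [Finset.mem_insert, Finset.mem_singleton]) <;> clear h1 h2 h3 <;>
        grind [→ Nbrs.facts]
    have hu' := hG.mem_of_twinFree ht h4
    obtain ⟨m, n, hz⟩ := exists_nbrs_of_adj hG.cubic hv.facts.1.2.2
    have hm := hu' m
    have hn := hu' n
    simp only [Finset.mem_insert, Finset.mem_singleton] at hm hn
    clear h1 h2 h3 h4 hu' ht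
    grind [→ Nbrs.facts]

/-- If the third neighbors of `r`, `s`, `t` coincide, the graph is K_{3,3}; two equal ones are
excluded by `Extremal.not_three_common`. If all three differ, then `p`, `r`, `s`, `t` already
dominate everything, so these neighbors can only be joined to one another and form a triangle. -/
theorem Extremal.iso_of_three_common (hG : Extremal G) (ht : TwinFree G)
    (hT : ∀ a b c, G.Adj a b → G.Adj b c → ¬ G.Adj a c) {p q r s t : V} (hpq : p ≠ q)
    (hp : Nbrs G p r s t) (hq : Nbrs G q r s t) : Nonempty (G ≃g K33) := by
  obtain ⟨r', hr⟩ := exists_nbrs_of_adj₂ hG.cubic hp.facts.1.1 hq.facts.1.1 hpq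
  obtain ⟨s', hs⟩ := exists_nbrs_of_adj₂ hG.cubic hp.facts.1.2.1 hq.facts.1.2.1 hpq
  obtain ⟨t', hv⟩ := exists_nbrs_of_adj₂ hG.cubic hp.facts.1.2.2 hq.facts.1.2.2 hpq
  have hrs : ¬ G.Adj r s := hT r p s hp.facts.1.1 hp.facts.1.2.1.symm
  have hrt : ¬ G.Adj r t := hT r p t hp.facts.1.1 hp.facts.1.2.2.symm
  have hst : ¬ G.Adj s t := hT s p t hp.facts.1.2.1 hp.facts.1.2.2.symm
  by_cases h12 : r' = s'
  · subst h12
    by_cases h13 : r' = t'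
    · subst h13
      refine nonempty_iso_K33 hG.conn hG.cubic (p := p) (q := q) (r := r') (s := r) (t := s)
        (u := t) ?_ ?_
      · simp
        grind [→ Nbrs.facts]
      · grind [→ Nbrs.facts]
    · exact (hG.not_three_common ht hp hq hr hs hv h13 hrs hrt hst).elim
  by_cases h13 : r' = t'
  · subst h13
    exact (hG.not_three_common ht hp.swap hq.swap hr hv hs h12 hrt hrs
      (fun h => hst h.symm)).elim
  by_cases h23 : s' = t'
  · subst h23
    exact (hG.not_three_common ht hp.rotate hq.rotate hs hv hr (Ne.symm h12) hst
      (fun h => hrs h.symm) (fun h => hrt h.symm)).elim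
  exfalso
  have h1 : Excess G {p, r, s, t} 2 := .of_nbrs hG.cubic hp
  have h2 : Excess G {q, r', p, r, s, t} 2 :=
    h1.insert₂ hG.cubic (v := r) (by simp) hr.rotate (by simp)
  have h3 : Excess G {s', q, r', p, r, s, t} 1 := by
    refine h2.insert₁ (v := s) ?_ ?_ ?_ ?_ <;>
      (try simp only [Finset.mem_insert, Finset.mem_singleton]) <;> clear h1 h2 <;>
      grind [→ Nbrs.facts]
  have h4 : Excess G {t', s', q, r', p, r, s, t} 0 := by
    refine h3.insert₁ (v := t) ?_ ?_ ?_ ?_ <;>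
      (try simp only [Finset.mem_insert, Finset.mem_singleton]) <;> clear h1 h2 h3 <;>
      grind [→ Nbrs.facts]
  have hu := hG.mem_of_twinFree ht h4
  simp only [Finset.mem_insert, Finset.mem_singleton] at hu
  have hsub : ∀ {r r' s' t' : V}, G.Adj r' r →
      (∀ z, G.Adj r' z → z = r ∨ z = s' ∨ z = t') → G.Adj r' s' ∧ G.Adj r' t' := by
    intro r r' s' t' hr h
    obtain ⟨m, n, hr'⟩ := exists_nbrs_of_adj hG.cubic hr
    have hm := h m hr'.facts.1.2.1.symm
    have hn := h n hr'.facts.1.2.2.symm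
    clear * - hm hn hr' hr
    grind [→ Nbrs.facts]
  have hr' := hsub hr.facts.1.2.2 (s' := s') (t' := t') (fun z hz => by
    have := hu z
    have := hz.symm
    have := hz.ne
    clear h1 h2 h3 h4 hu ht hT hsub
    grind [→ Nbrs.facts])
  have hs' := hsub hs.facts.1.2.2 (s' := r') (t' := t') (fun z hz => by
    have := hu z
    have := hz.symm
    have := hz.ne
    clear h1 h2 h3 h4 hu ht hT hsub
    grind [→ Nbrs.facts])
  exact hT _ _ _ hr'.1.symm hr'.2 hs'.2

set_option maxHeartbeats 1000000 in
-- Opposite corners with equal third neighbors have three common neighbors, which gives K_{3,3}.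
-- Otherwise `a`, `b`, `c`, `d` in turn reach excess 0, so there are only eight vertices, and the
-- four outer ones induce a 2-regular graph, that is, a 4-cycle. Of its three cyclic orders one
-- yields Q_3 and two yield TQ_3.
theorem Extremal.iso_of_square (hG : Extremal G) (ht : TwinFree G)
    (hT : ∀ a b c, G.Adj a b → G.Adj b c → ¬ G.Adj a c) {a b c d : V} (hab : G.Adj a b)
    (hbc : G.Adj b c) (hcd : G.Adj c d) (hda : G.Adj d a) (hac : a ≠ c) (hbd : b ≠ d) :
    Nonempty (G ≃g K33) ∨ Nonempty (G ≃g Q3) ∨ Nonempty (G ≃g TQ3) := by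
  obtain ⟨a', ha⟩ := exists_nbrs_of_adj₂ hG.cubic hab hda.symm hbd
  obtain ⟨b', hb⟩ := exists_nbrs_of_adj₂ hG.cubic hab.symm hbc hac
  obtain ⟨c', hc⟩ := exists_nbrs_of_adj₂ hG.cubic hbc.symm hcd hbd
  obtain ⟨d', hd⟩ := exists_nbrs_of_adj₂ hG.cubic hda hcd.symm hac
  by_cases hac' : a' = c'
  · subst hac'
    exact Or.inl (hG.iso_of_three_common ht hT hac ha hc)
  by_cases hbd' : b' = d'
  · subst hbd'
    exact Or.inl (hG.iso_of_three_common ht hT hbd hb hd)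
  right
  have hab' : a' ≠ b' := fun h =>
    hT a' a b ha.facts.1.2.2 hab (h ▸ hb.facts.1.2.2)
  have hbc' : b' ≠ c' := fun h =>
    hT b' b c hb.facts.1.2.2 hbc (h ▸ hc.facts.1.2.2)
  have hcd' : c' ≠ d' := fun h =>
    hT c' c d hc.facts.1.2.2 hcd (h ▸ hd.facts.1.2.2)
  have had' : a' ≠ d' := fun h =>
    hT a' a d ha.facts.1.2.2 hda.symm (h ▸ hd.facts.1.2.2)
  have nac : ¬ G.Adj a c := hT a b c hab hbc
  have nbd : ¬ G.Adj b d := hT b c d hbc hcd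
  have h1 : Excess G {a, b, d, a'} 2 := .of_nbrs hG.cubic ha
  have h2 : Excess G {c, b', a, b, d, a'} 2 :=
    h1.insert₂ hG.cubic (v := b) (by simp) hb.rotate (by simp)
  have h3 : Excess G {c', c, b', a, b, d, a'} 1 := by
    refine h2.insert₁ (v := c) ?_ ?_ ?_ ?_ <;>
      (try simp only [Finset.mem_insert, Finset.mem_singleton]) <;> clear h1 h2 <;>
      grind [→ Nbrs.facts]
  have h4 : Excess G {d', c', c, b', a, b, d, a'} 0 := by
    refine h3.insert₁ (v := d) ?_ ?_ ?_ ?_ <;>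
      (try simp only [Finset.mem_insert, Finset.mem_singleton]) <;> clear h1 h2 h3 <;>
      grind [→ Nbrs.facts]
  have hu := hG.mem_of_twinFree ht h4
  simp only [Finset.mem_insert, Finset.mem_singleton] at hu
  have hsub : ∀ {a a' b' c' d' : V}, G.Adj a' a →
      (∀ z, G.Adj a' z → z = a ∨ z = b' ∨ z = c' ∨ z = d') →
      (G.Adj a' b' ∧ G.Adj a' c' ∨ G.Adj a' b' ∧ G.Adj a' d' ∨ G.Adj a' c' ∧ G.Adj a' d') := by
    intro a a' b' c' d' h h'
    obtain ⟨m, n, ha'⟩ := exists_nbrs_of_adj hG.cubic h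
    have hm := h' m ha'.facts.1.2.1.symm
    have hn := h' n ha'.facts.1.2.2.symm
    clear * - hm hn ha' h
    grind [→ Nbrs.facts]
  have ha' := hsub ha.facts.1.2.2 (b' := b') (c' := c') (d' := d') (fun z hz => by
    have := hu z
    have := hz.symm
    have := hz.ne
    clear h1 h2 h3 h4 hu ht hT hsub
    grind [→ Nbrs.facts])
  have hb' := hsub hb.facts.1.2.2 (b' := a') (c' := c') (d' := d') (fun z hz => by
    have := hu z
    have := hz.symm
    have := hz.ne
    clear h1 h2 h3 h4 hu ht hT hsub
    grind [→ Nbrs.facts])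
  have hc' := hsub hc.facts.1.2.2 (b' := a') (c' := b') (d' := d') (fun z hz => by
    have := hu z
    have := hz.symm
    have := hz.ne
    clear h1 h2 h3 h4 hu ht hT hsub
    grind [→ Nbrs.facts])
  have hd' := hsub hd.facts.1.2.2 (b' := a') (c' := b') (d' := c') (fun z hz => by
    have := hu z
    have := hz.symm
    have := hz.ne
    clear h1 h2 h3 h4 hu ht hT hsub
    grind [→ Nbrs.facts])
  have tabc := hT a' b' c'
  have tabd := hT a' b' d'
  have tacd := hT a' c' d'
  have tbcd := hT b' c' d'
  have hcyc : (G.Adj a' b' ∧ G.Adj b' c' ∧ G.Adj c' d' ∧ G.Adj d' a') ∨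
      (G.Adj a' b' ∧ G.Adj b' d' ∧ G.Adj d' c' ∧ G.Adj c' a') ∨
      (G.Adj a' c' ∧ G.Adj c' b' ∧ G.Adj b' d' ∧ G.Adj d' a') := by
    rw [G.adj_comm b' a'] at hb'
    rw [G.adj_comm c' a', G.adj_comm c' b'] at hc'
    rw [G.adj_comm d' a', G.adj_comm d' b', G.adj_comm d' c'] at hd'
    rw [G.adj_comm d' c', G.adj_comm d' a', G.adj_comm c' a', G.adj_comm c' b']
    clear * - ha' hb' hc' hd' tabc tabd tacd tbcd
    tauto
  have hnd : [a, b, c, d, a', b', c', d'].Nodup := by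
    simp
    clear * - ha hb hc hd hac' hbd' hab' hbc' hcd' had' nac nbd hac hbd hG
    grind [→ Nbrs.facts]
  have haa := ha.facts.1.2.2.symm
  have hbb := hb.facts.1.2.2.symm
  have hcc := hc.facts.1.2.2.symm
  have hdd := hd.facts.1.2.2.symm
  rcases hcyc with ⟨e1, e2, e3, e4⟩ | ⟨e1, e2, e3, e4⟩ | ⟨e1, e2, e3, e4⟩
  · exact Or.inl (nonempty_iso_Q3 hG.conn hG.cubic hnd
      (by simp only [hab, hbc, hcd, hda.symm, haa, hbb, hcc, hdd, e1, e2, e3, e4.symm, and_self]))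
  · right
    refine nonempty_iso_TQ3 hG.conn hG.cubic (a := a) (b := b) (c := c) (d := d) (a' := a')
      (b' := b') (c' := d') (d' := c') ?_
      (by simp only [hab, hbc, hcd, hda.symm, haa, hbb, hcc, hdd, e1, e2, e3, e4.symm, and_self])
    simp
    clear * - ha hb hc hd hac' hbd' hab' hbc' hcd' had' nac nbd hac hbd hG
    grind [→ Nbrs.facts]
  · right
    refine nonempty_iso_TQ3 hG.conn hG.cubic (a := b) (b := c) (c := d) (d := a) (a' := b')
      (b' := c') (c' := a') (d' := d') ?_ (by
        simp only [hab.symm, hbc, hcd, hda, haa, hbb, hcc, hdd, e1.symm, e2.symm, e3, e4.symm,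
          and_self])
    simp
    clear * - ha hb hc hd hac' hbd' hab' hbc' hcd' had' nac nbd hac hbd hG
    grind [→ Nbrs.facts]

end TriangleFree

/-! ### No twins, girth at least 5 -/

section LargeGirth

variable {V : Type*} [Fintype V] [DecidableEq V] {G : SimpleGraph V} [DecidableRel G.Adj]

/-- The vertices of `D` with a neighbor outside `D`. -/
def boundary (G : SimpleGraph V) [DecidableRel G.Adj] (D : Finset V) : Finset V :=
  D.filter fun d => ¬ closedNbhdFinset G d ⊆ D

/-- A dominated set that has grown like a tree. -/
structure TreeLike (G : SimpleGraph V) [DecidableRel G.Adj] (D : Finset V) : Prop where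
  excess : Excess G D 2
  two : ∀ d ∈ boundary G D, (closedNbhdFinset G d \ D).card = 2
  uniq : ∀ u ∉ D, ∀ d ∈ D, ∀ d' ∈ D, G.Adj u d → G.Adj u d' → d = d'
  three_le : 3 ≤ (boundary G D).card
  seven_le : 7 ≤ Dᶜ.card

/-- The pairs of outer neighbors of distinct boundary vertices are disjoint. -/
theorem two_mul_card_boundary_le {D : Finset V}
    (two : ∀ d ∈ boundary G D, (closedNbhdFinset G d \ D).card = 2)
    (uniq : ∀ u ∉ D, ∀ d ∈ D, ∀ d' ∈ D, G.Adj u d → G.Adj u d' → d = d') :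
    2 * (boundary G D).card ≤ Dᶜ.card := by
  have h1 : ((boundary G D).biUnion fun d => closedNbhdFinset G d \ D).card =
      ∑ d ∈ boundary G D, (closedNbhdFinset G d \ D).card := by
    apply Finset.card_biUnion
    intro d hd e he hde
    refine Finset.disjoint_left.2 fun u hu hu' => ?_
    have hd := (Finset.mem_filter.1 hd).1
    have he := (Finset.mem_filter.1 he).1
    rw [Finset.mem_sdiff, mem_closedNbhdFinset] at hu hu'
    apply hde
    apply uniq u hu.2 d hd e he
    · rcases hu.1 with rfl | h
      · exact absurd hd hu.2
      · exact h.symm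
    · rcases hu'.1 with rfl | h
      · exact absurd he hu.2
      · exact h.symm
  rw [Finset.sum_congr rfl two, Finset.sum_const, smul_eq_mul] at h1
  rw [mul_comm, ← h1]
  apply Finset.card_le_card
  intro u hu
  obtain ⟨d, -, hu⟩ := Finset.mem_biUnion.1 hu
  exact Finset.mem_compl.2 (Finset.mem_sdiff.1 hu).2

theorem TreeLike.exists_nbrs (h3 : G.IsRegularOfDegree 3) {D : Finset V} (hD : TreeLike G D)
    {d : V} (hd : d ∈ boundary G D) : ∃ u₁ u₂ w, Nbrs G d u₁ u₂ w ∧ u₁ ∉ D ∧ u₂ ∉ D ∧ w ∈ D := by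
  obtain ⟨u₁, u₂, hne, hu⟩ := Finset.card_eq_two.1 (hD.two d hd)
  have hmem : ∀ z, z ∈ closedNbhdFinset G d \ D ↔ z = u₁ ∨ z = u₂ := fun z => by rw [hu]; simp
  have hd := (Finset.mem_filter.1 hd).1
  have hadj : ∀ z, z = u₁ ∨ z = u₂ → G.Adj d z ∧ z ∉ D := by
    intro z hz
    have := (hmem z).2 hz
    rw [Finset.mem_sdiff, mem_closedNbhdFinset] at this
    rcases this.1 with rfl | h
    · exact absurd hd this.2
    · exact ⟨h, this.2⟩
  obtain ⟨w, hn⟩ := exists_nbrs_of_adj₂ h3 (hadj u₁ (by simp)).1 (hadj u₂ (by simp)).1 hne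
  refine ⟨u₁, u₂, w, hn, (hadj u₁ (by simp)).2, (hadj u₂ (by simp)).2, ?_⟩
  by_contra hw
  rcases (hmem w).1 (Finset.mem_sdiff.2 ⟨by simp [hn.mem_iff], hw⟩) with h | h
  · exact hn.ne₁₃ h.symm
  · exact hn.ne₂₃ h.symm

/-- Such an edge closes a cycle outside the tree. With `t`, `s`, `r` the remaining outer neighbors
of `u₁`, `d'`, `u`, the terms `d`, `u₁` gain two vertices each and `d'`, `u` one each. The excess
falls from 2 to 0, so everything is dominated although only six vertices were added to `D`, while at
least seven were missing. -/
theorem TreeLike.not_adj (hG : Extremal G) (ht : TwinFree G)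
    (hT : ∀ a b c, G.Adj a b → G.Adj b c → ¬ G.Adj a c)
    (hQ : ∀ a b c d, G.Adj a b → G.Adj b c → G.Adj c d → G.Adj d a → a = c ∨ b = d)
    {D : Finset V} (hD : TreeLike G D) {d u₁ u₂ w : V} (hn : Nbrs G d u₁ u₂ w) (hd : d ∈ D)
    (hw : w ∈ D) (h₁ : u₁ ∉ D) (h₂ : u₂ ∉ D) {u d' : V} (hu : u ∉ D) (hu₁ : G.Adj u u₁)
    (hd' : d' ∈ D) (hud : G.Adj u d') : False := by
  have adj := hn.facts.1
  have hdd : d ≠ d' := by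
    rintro rfl
    exact hT _ _ _ hu₁ adj.1 hud
  have hbd : d' ∈ boundary G D := by
    refine Finset.mem_filter.2 ⟨hd', fun h => hu (h ?_)⟩
    exact mem_closedNbhdFinset.2 (Or.inr hud.symm)
  obtain ⟨s, w', hs, hsD, hw'⟩ : ∃ s w', Nbrs G d' u s w' ∧ s ∉ D ∧ w' ∈ D := by
    obtain ⟨p, q, w', hp, hpD, hqD, hw'⟩ := hD.exists_nbrs hG.cubic hbd
    rcases (hp.adj_iff u).1 hud.symm with rfl | rfl | rfl
    · exact ⟨_, _, hp, hqD, hw'⟩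
    · exact ⟨_, _, hp.swap.rotate.rotate, hpD, hw'⟩
    · exact absurd hw' hu
  have hsadj := hs.facts.1
  have hs₁ : s ≠ u₁ := by
    rintro rfl
    exact hdd (hD.uniq s hsD d hd d' hd' adj.1 hsadj.2.1)
  have hs₂ : s ≠ u₂ := by
    rintro rfl
    exact hdd (hD.uniq s hsD d hd d' hd' adj.2.1 hsadj.2.1)
  have hud' : d ≠ u := fun h => hu (h ▸ hd)
  obtain ⟨t, ht₁⟩ := exists_nbrs_of_adj₂ hG.cubic adj.1 hu₁.symm hud'
  have htadj := ht₁.facts.1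
  have htD : t ∉ D := fun h => ht₁.ne₁₃ (hD.uniq u₁ h₁ d hd t h adj.1 htadj.2.2.symm)
  have ht₂ : t ≠ u₂ := by
    rintro rfl
    exact hT _ _ _ htadj.2.2 adj.1 adj.2.1
  have hts : t ≠ s := by
    rintro rfl
    rcases hQ u₁ t d' u htadj.2.2.symm hsadj.2.1 hud.symm hu₁ with h | h
    · exact h₁ (h ▸ hd')
    · exact hs.ne₁₂ h.symm
  have hu₁d' : u₁ ≠ d' := fun h => h₁ (h ▸ hd')
  obtain ⟨r, hr⟩ := exists_nbrs_of_adj₂ hG.cubic hu₁ hud hu₁d'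
  have hradj := hr.facts.1
  have hrD : r ∉ D := fun h => hr.ne₂₃ (hD.uniq u hu d' hd' r h hud hradj.2.2.symm)
  have hr₂ : r ≠ u₂ := by
    rintro rfl
    rcases hQ u u₁ d r hu₁ adj.1 adj.2.1.symm hradj.2.2 with h | h
    · exact hud' h.symm
    · exact hn.ne₁₂ h
  have hrt : r ≠ t := by
    rintro rfl
    exact hT _ _ _ hu₁ htadj.2.2.symm hradj.2.2.symm
  have hrs : r ≠ s := by
    rintro rfl
    exact hT _ _ _ hud hsadj.2.1.symm hradj.2.2.symm
  have hu₂ : u ≠ u₂ := by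
    rintro rfl
    exact hT _ _ _ hu₁ adj.1 adj.2.1
  have e1 : Excess G (insert u₁ (insert u₂ D)) 2 := hD.excess.insert₂ hG.cubic hd hn hw
  have e2 : Excess G (insert u (insert t (insert u₁ (insert u₂ D)))) 2 :=
    e1.insert₂ hG.cubic (v := u₁) (by simp) ht₁.rotate (by simp [hd])
  have e3 : Excess G (insert s (insert u (insert t (insert u₁ (insert u₂ D))))) 1 := by
    refine e2.insert₁ (v := d') (by simp [hd']) hsadj.2.1.symm ?_ ?_
    · simp [hs₁, hs₂, hts.symm, hsD, hs.ne₁₂.symm]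
    · intro z hz
      rcases (hs.adj_iff z).1 hz with rfl | rfl | rfl <;> simp [*]
  have e4 : Excess G (insert r (insert s (insert u (insert t (insert u₁ (insert u₂ D)))))) 0 := by
    refine e3.insert₁ (v := u) (by simp) hradj.2.2.symm ?_ ?_
    · simp [hr₂, hrt, hrs, hrD, hr.ne₁₃.symm, hradj.2.2.ne]
    · intro z hz
      rcases (hr.adj_iff z).1 hz with rfl | rfl | rfl <;> simp [*]
  have hsub : Dᶜ ⊆ {r, s, u, t, u₁, u₂} := by
    intro z hz
    have := hG.mem_of_twinFree ht e4 z
    have := Finset.mem_compl.1 hz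
    simp only [Finset.mem_insert, Finset.mem_singleton] at *
    tauto
  have := (Finset.card_le_card hsub).trans Finset.card_le_six
  have := hD.seven_le
  omega

/-- Any boundary vertex serves. Girth at least 5 handles two new vertices with a common outer
neighbor, and `TreeLike.not_adj` a new and an old one. -/
theorem TreeLike.step (hG : Extremal G) (ht : TwinFree G)
    (hT : ∀ a b c, G.Adj a b → G.Adj b c → ¬ G.Adj a c)
    (hQ : ∀ a b c d, G.Adj a b → G.Adj b c → G.Adj c d → G.Adj d a → a = c ∨ b = d)
    {D : Finset V} (hD : TreeLike G D) :
    ∃ d, ¬ closedNbhdFinset G d ⊆ D ∧ TreeLike G (D ∪ closedNbhdFinset G d) := by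
  obtain ⟨d, hdb⟩ : (boundary G D).Nonempty := Finset.card_pos.1 (by have := hD.three_le; omega)
  obtain ⟨u₁, u₂, w, hn, h₁, h₂, hw⟩ := hD.exists_nbrs hG.cubic hdb
  have hd : d ∈ D := (Finset.mem_filter.1 hdb).1
  have adj := hn.facts.1
  refine ⟨d, (Finset.mem_filter.1 hdb).2, ?_⟩
  have hmem : ∀ z, z ∈ D ∪ closedNbhdFinset G d ↔ z = u₁ ∨ z = u₂ ∨ z ∈ D := by
    intro z
    rw [Finset.mem_union, hn.mem_iff]
    constructor
    · rintro (h | rfl | h | h | rfl) <;> tauto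
    · tauto
  have hnew : ∀ {u₁ u₂ : V}, G.Adj u₁ d → G.Adj u₂ d → u₁ ∉ D →
      (∀ z, z ∈ D ∪ closedNbhdFinset G d ↔ z = u₁ ∨ z = u₂ ∨ z ∈ D) →
      (closedNbhdFinset G u₁ \ (D ∪ closedNbhdFinset G d)).card = 2 := by
    intro u₁ u₂ h₁d h₂d h₁ hmem
    obtain ⟨x, y, hx⟩ := exists_nbrs_of_adj hG.cubic h₁d
    refine Finset.card_eq_two.2 ⟨x, y, hx.ne₂₃, ?_⟩
    have hxadj := hx.facts.1
    have hout : ∀ z, d ≠ z → G.Adj u₁ z → ¬ (z = u₁ ∨ z = u₂ ∨ z ∈ D) := by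
      rintro z hdz hz (rfl | rfl | hzD)
      · exact hz.ne rfl
      · exact hT _ _ _ hz h₂d h₁d
      · exact hdz (hD.uniq u₁ h₁ d hd z hzD h₁d hz)
    ext z
    rw [Finset.mem_sdiff, hmem, hx.mem_iff, Finset.mem_insert, Finset.mem_singleton]
    constructor
    · rintro ⟨rfl | rfl | h, hz⟩
      · exact absurd (Or.inl rfl) hz
      · exact absurd (Or.inr (Or.inr hd)) hz
      · exact h
    · rintro (rfl | rfl)
      · exact ⟨by simp, hout _ hx.ne₁₂ hxadj.2.1.symm⟩
      · exact ⟨by simp, hout _ hx.ne₁₃ hxadj.2.2.symm⟩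
  have hmem' : ∀ z, z ∈ D ∪ closedNbhdFinset G d ↔ z = u₂ ∨ z = u₁ ∨ z ∈ D := by
    intro z
    rw [hmem]
    tauto
  have hnew₁ := hnew adj.1 adj.2.1 h₁ hmem
  have hnew₂ := hnew adj.2.1 adj.1 h₂ hmem'
  have hold : ∀ e ∈ D, e ≠ d →
      closedNbhdFinset G e \ (D ∪ closedNbhdFinset G d) = closedNbhdFinset G e \ D := by
    intro e he hed
    ext z
    rw [Finset.mem_sdiff, Finset.mem_sdiff, hmem]
    have hz : ∀ u, u ∉ D → G.Adj u d → z = u → z ∉ closedNbhdFinset G e := by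
      rintro u hu hud rfl hz
      rcases mem_closedNbhdFinset.1 hz with rfl | hz
      · exact hu he
      · exact hed (hD.uniq z hu e he d hd hz.symm hud)
    have := hz u₁ h₁ adj.1
    have := hz u₂ h₂ adj.2.1
    tauto
  have huniq : ∀ u ∉ D ∪ closedNbhdFinset G d, ∀ p ∈ D ∪ closedNbhdFinset G d,
      ∀ q ∈ D ∪ closedNbhdFinset G d, G.Adj u p → G.Adj u q → p = q := by
    intro u hu p hp q hq hup huq
    rw [hmem] at hu hp hq
    push Not at hu
    have hsq : ∀ {p q : V}, G.Adj p d → G.Adj q d → G.Adj u p → G.Adj u q → p = q := by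
      intro p q hpd hqd hup huq
      rcases hQ d p u q hpd.symm hup.symm huq hqd with h | h
      · exact absurd (h ▸ hd) hu.2.2
      · exact h
    have hne : ∀ p, (p = u₁ ∨ p = u₂) → G.Adj u p → ∀ q ∈ D, G.Adj u q → False := by
      rintro p (rfl | rfl) hup q hq huq
      · exact hD.not_adj hG ht hT hQ hn hd hw h₁ h₂ hu.2.2 hup hq huq
      · exact hD.not_adj hG ht hT hQ hn.swap.rotate.rotate hd hw h₂ h₁ hu.2.2 hup hq huq
    have hadj : ∀ p, (p = u₁ ∨ p = u₂) → G.Adj p d := by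
      rintro p (rfl | rfl)
      · exact adj.1
      · exact adj.2.1
    rw [← or_assoc] at hp hq
    rcases hp with hp | hp
    · rcases hq with hq | hq
      · exact hsq (hadj p hp) (hadj q hq) hup huq
      · exact (hne p hp hup q hq huq).elim
    · rcases hq with hq | hq
      · exact (hne q hq huq p hp hup).elim
      · exact hD.uniq u hu.2.2 p hp q hq hup huq
  have htwo : ∀ e ∈ boundary G (D ∪ closedNbhdFinset G d),
      (closedNbhdFinset G e \ (D ∪ closedNbhdFinset G d)).card = 2 := by
    intro e he
    obtain ⟨he, hsub⟩ := Finset.mem_filter.1 he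
    rcases (hmem e).1 he with rfl | rfl | he
    · exact hnew₁
    · exact hnew₂
    · by_cases hed : e = d
      · exact absurd (hed ▸ Finset.subset_union_right) hsub
      · rw [hold e he hed]
        refine hD.two e (Finset.mem_filter.2 ⟨he, fun h => hsub ?_⟩)
        exact h.trans Finset.subset_union_left
  -- `d` leaves the boundary while `u₁` and `u₂` enter it: 3 - 1 + 2 = 4.
  have hcard : 4 ≤ (boundary G (D ∪ closedNbhdFinset G d)).card := by
    have hsub : insert u₁ (insert u₂ ((boundary G D).erase d)) ⊆
        boundary G (D ∪ closedNbhdFinset G d) := by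
      intro e he
      rw [Finset.mem_insert, Finset.mem_insert, Finset.mem_erase] at he
      rw [boundary, Finset.mem_filter, hmem, ← Finset.sdiff_eq_empty_iff_subset]
      rcases he with rfl | rfl | ⟨hed, he⟩
      · refine ⟨by simp, fun h => ?_⟩
        rw [h] at hnew₁
        simp at hnew₁
      · refine ⟨by simp, fun h => ?_⟩
        rw [h] at hnew₂
        simp at hnew₂
      · obtain ⟨he, hsub⟩ := Finset.mem_filter.1 he
        rw [hold e he hed, Finset.sdiff_eq_empty_iff_subset]
        exact ⟨by simp [he], hsub⟩
    have h := Finset.card_le_card hsub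
    have hb : ∀ u ∉ D, u ∉ (boundary G D).erase d := fun u hu h =>
      hu (Finset.mem_filter.1 (Finset.mem_erase.1 h).2).1
    have hb₁ : u₁ ∉ insert u₂ ((boundary G D).erase d) := by
      simp only [Finset.mem_insert, hn.ne₁₂, hb u₁ h₁, or_self, not_false_eq_true]
    rw [Finset.card_insert_of_notMem hb₁, Finset.card_insert_of_notMem (hb u₂ h₂), Finset.card_erase_of_mem hdb] at h
    have := hD.three_le
    omega
  refine ⟨hD.excess.step hG.cubic hd, htwo, huniq, by omega, ?_⟩
  -- Four boundary vertices require eight undominated vertices, so the bound 7 renews itself.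
  have := two_mul_card_boundary_le htwo huniq
  omega

theorem Extremal.not_treeLike (hG : Extremal G) (ht : TwinFree G)
    (hT : ∀ a b c, G.Adj a b → G.Adj b c → ¬ G.Adj a c)
    (hQ : ∀ a b c d, G.Adj a b → G.Adj b c → G.Adj c d → G.Adj d a → a = c ∨ b = d)
    {D : Finset V} : ¬ TreeLike G D := by
  intro hD
  induction hn : Dᶜ.card using Nat.strong_induction_on generalizing D with
  | _ n ih =>
    obtain ⟨d, hd, hD'⟩ := hD.step hG ht hT hQ
    exact ih _ (hn ▸ card_compl_union_lt hd) hD' rfl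

/-- With at least 11 vertices, N[v] leaves at least 7 undominated, which is what starts the
impossible tree-like growth. -/
theorem Extremal.card_le_ten (hG : Extremal G) (ht : TwinFree G)
    (hT : ∀ a b c, G.Adj a b → G.Adj b c → ¬ G.Adj a c)
    (hQ : ∀ a b c d, G.Adj a b → G.Adj b c → G.Adj c d → G.Adj d a → a = c ∨ b = d) :
    Fintype.card V ≤ 10 := by
  by_contra! hcard
  obtain ⟨v⟩ := hG.conn.nonempty
  obtain ⟨a, b, c, hv⟩ := exists_nbrs hG.cubic v
  have hmem : ∀ z, z ∈ ({v, a, b, c} : Finset V) ↔ z = v ∨ G.Adj v z := by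
    simp [hv.adj_iff]
  have hleaf : ∀ d, G.Adj v d → (closedNbhdFinset G d \ {v, a, b, c}).card = 2 := by
    intro d hd
    obtain ⟨x, y, hn⟩ := exists_nbrs_of_adj hG.cubic hd.symm
    have adj := hn.facts.1
    refine Finset.card_eq_two.2 ⟨x, y, hn.ne₂₃, ?_⟩
    ext z
    rw [Finset.mem_sdiff, hmem, hn.mem_iff, Finset.mem_insert, Finset.mem_singleton]
    constructor
    · rintro ⟨rfl | rfl | h, hz⟩
      · exact absurd (Or.inr hd) hz
      · exact absurd (Or.inl rfl) hz
      · exact h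
    · rintro (rfl | rfl)
      · refine ⟨by simp, ?_⟩
        rintro (h | h)
        · exact hn.ne₁₂ h.symm
        · exact hT _ _ _ hd adj.2.1.symm h
      · refine ⟨by simp, ?_⟩
        rintro (h | h)
        · exact hn.ne₁₃ h.symm
        · exact hT _ _ _ hd adj.2.2.symm h
  have hne : ∀ d, G.Adj v d → ¬ closedNbhdFinset G d ⊆ {v, a, b, c} := by
    intro d hd h
    have := hleaf d hd
    rw [Finset.sdiff_eq_empty_iff_subset.2 h] at this
    simp at this
  refine hG.not_treeLike ht hT hQ (D := {v, a, b, c})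
    ⟨.of_nbrs hG.cubic hv, fun d hd => ?_, fun u hu d hd d' hd' hud hud' => ?_, ?_, ?_⟩
  · obtain ⟨hd, hsub⟩ := Finset.mem_filter.1 hd
    rcases (hmem d).1 hd with rfl | hd
    · refine absurd (fun z hz => ?_) hsub
      rw [hmem]
      exact mem_closedNbhdFinset.1 hz
    · exact hleaf d hd
  · rw [hmem] at hu hd hd'
    push Not at hu
    rcases hd with rfl | hd
    · exact absurd hud.symm hu.2
    rcases hd' with rfl | hd'
    · exact absurd hud'.symm hu.2
    rcases hQ v d u d' hd hud.symm hud' hd'.symm with h | h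
    · exact absurd h.symm hu.1
    · exact h
  · have hsub : {a, b, c} ⊆ boundary G {v, a, b, c} := by
      intro z hz
      have hz : G.Adj v z := (hv.adj_iff z).2 (by simpa using hz)
      exact Finset.mem_filter.2 ⟨(hmem z).2 (Or.inr hz), hne z hz⟩
    refine le_trans (le_of_eq ?_) (Finset.card_le_card hsub)
    exact (Finset.card_eq_three.2 ⟨a, b, c, hv.ne₁₂, hv.ne₁₃, hv.ne₂₃, rfl⟩).symm
  · have := Finset.card_le_four (a := v) (b := a) (c := b) (d := c)
    rw [Finset.card_compl]
    omega

theorem adj_and_adj_of_forall (h3 : G.IsRegularOfDegree 3) {u p q r : V} (hp : G.Adj u p)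
    (h : ∀ z, G.Adj u z → z = p ∨ z = q ∨ z = r) : G.Adj u q ∧ G.Adj u r := by
  obtain ⟨m, n, hn⟩ := exists_nbrs_of_adj h3 hp
  have hm := h m hn.facts.1.2.1.symm
  have hn' := h n hn.facts.1.2.2.symm
  clear h
  grind [→ Nbrs.facts]

/-- All remaining edges join grandchildren of `v`, and the absence of triangles and 4-cycles
determines them one by one. -/
theorem nonempty_iso_petersen_of_girth (hc : G.Connected) (h3 : G.IsRegularOfDegree 3)
    (hT : ∀ a b c, G.Adj a b → G.Adj b c → ¬ G.Adj a c)
    (hQ : ∀ a b c d, G.Adj a b → G.Adj b c → G.Adj c d → G.Adj d a → a = c ∨ b = d)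
    {v a b c a₁ a₂ b₁ b₂ c₁ c₂ : V} (hv : Nbrs G v a b c) (ha : Nbrs G a v a₁ a₂)
    (hb : Nbrs G b v b₁ b₂) (hc' : Nbrs G c v c₁ c₂)
    (hnd : [v, a, b, c, a₁, a₂, b₁, b₂, c₁, c₂].Nodup)
    (hu : ∀ z, z ∈ [v, a, b, c, a₁, a₂, b₁, b₂, c₁, c₂]) (hab : G.Adj a₁ b₁)
    (hac : G.Adj a₁ c₁) : Nonempty (G ≃g petersen) := by
  have hba : ¬ G.Adj a₂ b₁ := fun h => by
    rcases hQ a a₁ b₁ a₂ ha.facts.1.2.1.symm hab h.symm ha.facts.1.2.2 with h | h <;>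
      simp [h] at hnd
  have hca : ¬ G.Adj a₂ c₁ := fun h => by
    rcases hQ a a₁ c₁ a₂ ha.facts.1.2.1.symm hac h.symm ha.facts.1.2.2 with h | h <;>
      simp [h] at hnd
  simp only [List.mem_cons, List.not_mem_nil, or_false] at hu
  have hnd' := hnd
  simp only [List.nodup_cons, List.mem_cons, List.not_mem_nil, or_false, not_or] at hnd
  obtain ⟨e1, e2⟩ : G.Adj a₂ b₂ ∧ G.Adj a₂ c₂ := by
    refine adj_and_adj_of_forall h3 ha.facts.1.2.2 fun z hz => ?_
    have hz' := hz.symm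
    have := hT z a₂ a hz'
    clear hT hQ
    rcases hu z with rfl | rfl | rfl | rfl | rfl | rfl | rfl | rfl | rfl | rfl <;>
      grind [→ Nbrs.facts]
  have hbb : ∀ z, G.Adj z b₁ → G.Adj z b₂ → z = b := by
    intro z h1 h2
    rcases hQ b b₁ z b₂ hb.facts.1.2.1.symm h1.symm h2 hb.facts.1.2.2 with h | h
    · exact h.symm
    · exact absurd h hb.ne₂₃
  have hab' := hab.symm
  have hac' := hac.symm
  have e1' := e1.symm
  have e2' := e2.symm
  have e3 : G.Adj b₁ c₂ := by
    refine (adj_and_adj_of_forall h3 hb.facts.1.2.1 (q := a₁) fun z hz => ?_).2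
    have hz' := hz.symm
    have := hT z b₁ b hz'
    have := hT z b₁ a₁ hz' hab.symm
    clear hT hQ
    rcases hu z with rfl | rfl | rfl | rfl | rfl | rfl | rfl | rfl | rfl | rfl <;>
      grind [→ Nbrs.facts]
  have e3' := e3.symm
  have e4 : G.Adj b₂ c₁ := by
    refine (adj_and_adj_of_forall h3 hb.facts.1.2.2 (q := a₂) fun z hz => ?_).2
    have hz' := hz.symm
    have := hT z b₂ b hz'
    have := hT z b₂ a₂ hz' e1.symm
    clear hT hQ
    rcases hu z with rfl | rfl | rfl | rfl | rfl | rfl | rfl | rfl | rfl | rfl <;>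
      grind [→ Nbrs.facts]
  have e4' := e4.symm
  -- The outer pentagon is `v`, `a`, `a₁`, `b₁`, `b`.
  refine nonempty_iso_petersen hc h3 (v₀ := v) (v₁ := a) (v₂ := a₁) (v₃ := b₁) (v₄ := b)
    (w₀ := c) (w₁ := a₂) (w₂ := c₁) (w₃ := c₂) (w₄ := b₂) ?_ ?_
  · simp
    clear hT hQ hu
    grind
  · clear hT hQ hu
    grind [→ Nbrs.facts]

set_option maxHeartbeats 1000000 in
-- In girth at least 5 the ball of radius 2 has ten vertices, hence is everything. The vertex `a₁`
-- has one neighbor among the children of `b` and one among those of `c`, since two in the same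
-- family would close a 4-cycle; renaming reduces to `b₁` and `c₁`.
theorem Extremal.iso_petersen (hG : Extremal G) (ht : TwinFree G)
    (hT : ∀ a b c, G.Adj a b → G.Adj b c → ¬ G.Adj a c)
    (hQ : ∀ a b c d, G.Adj a b → G.Adj b c → G.Adj c d → G.Adj d a → a = c ∨ b = d) :
    Nonempty (G ≃g petersen) := by
  obtain ⟨v⟩ := hG.conn.nonempty
  obtain ⟨a, b, c, hv⟩ := exists_nbrs hG.cubic v
  obtain ⟨a₁, a₂, ha⟩ := exists_nbrs_of_adj hG.cubic hv.facts.1.1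
  obtain ⟨b₁, b₂, hb⟩ := exists_nbrs_of_adj hG.cubic hv.facts.1.2.1
  obtain ⟨c₁, c₂, hc⟩ := exists_nbrs_of_adj hG.cubic hv.facts.1.2.2
  have hchild : ∀ {a b x y : V}, G.Adj v a → G.Adj v b → a ≠ b → G.Adj a x → G.Adj b y →
      x ≠ v → y ≠ v → x ≠ y ∧ x ≠ b ∧ y ≠ a := by
    intro a b x y ha hb hab hx hy hxv hyv
    refine ⟨?_, ?_, ?_⟩
    · rintro rfl
      rcases hQ v a x b ha hx hy.symm hb.symm with h | h
      · exact hxv h.symm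
      · exact hab h
    · rintro rfl
      exact hT _ _ _ ha hx hb
    · rintro rfl
      exact hT _ _ _ hb hy ha
  have hnd : [v, a, b, c, a₁, a₂, b₁, b₂, c₁, c₂].Nodup := by
    have hab : ∀ {x y}, G.Adj a x → G.Adj b y → x ≠ v → y ≠ v → x ≠ y ∧ x ≠ b ∧ y ≠ a :=
      hchild hv.facts.1.1.symm hv.facts.1.2.1.symm hv.ne₁₂
    have hac : ∀ {x y}, G.Adj a x → G.Adj c y → x ≠ v → y ≠ v → x ≠ y ∧ x ≠ c ∧ y ≠ a :=
      hchild hv.facts.1.1.symm hv.facts.1.2.2.symm hv.ne₁₃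
    have hbc : ∀ {x y}, G.Adj b x → G.Adj c y → x ≠ v → y ≠ v → x ≠ y ∧ x ≠ c ∧ y ≠ b :=
      hchild hv.facts.1.2.1.symm hv.facts.1.2.2.symm hv.ne₂₃
    have hab₁ := @hab _ _ ha.facts.1.2.1.symm hb.facts.1.2.1.symm ha.ne₁₂.symm hb.ne₁₂.symm
    have hab₂ := @hab _ _ ha.facts.1.2.1.symm hb.facts.1.2.2.symm ha.ne₁₂.symm hb.ne₁₃.symm
    have hab₃ := @hab _ _ ha.facts.1.2.2.symm hb.facts.1.2.1.symm ha.ne₁₃.symm hb.ne₁₂.symm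
    have hab₄ := @hab _ _ ha.facts.1.2.2.symm hb.facts.1.2.2.symm ha.ne₁₃.symm hb.ne₁₃.symm
    have hac₁ := @hac _ _ ha.facts.1.2.1.symm hc.facts.1.2.1.symm ha.ne₁₂.symm hc.ne₁₂.symm
    have hac₂ := @hac _ _ ha.facts.1.2.1.symm hc.facts.1.2.2.symm ha.ne₁₂.symm hc.ne₁₃.symm
    have hac₃ := @hac _ _ ha.facts.1.2.2.symm hc.facts.1.2.1.symm ha.ne₁₃.symm hc.ne₁₂.symm
    have hac₄ := @hac _ _ ha.facts.1.2.2.symm hc.facts.1.2.2.symm ha.ne₁₃.symm hc.ne₁₃.symm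
    have hbc₁ := @hbc _ _ hb.facts.1.2.1.symm hc.facts.1.2.1.symm hb.ne₁₂.symm hc.ne₁₂.symm
    have hbc₂ := @hbc _ _ hb.facts.1.2.1.symm hc.facts.1.2.2.symm hb.ne₁₂.symm hc.ne₁₃.symm
    have hbc₃ := @hbc _ _ hb.facts.1.2.2.symm hc.facts.1.2.1.symm hb.ne₁₃.symm hc.ne₁₂.symm
    have hbc₄ := @hbc _ _ hb.facts.1.2.2.symm hc.facts.1.2.2.symm hb.ne₁₃.symm hc.ne₁₃.symm
    simp
    clear hT hQ hchild hab hac hbc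
    grind [→ Nbrs.facts]
  have hu : ∀ z, z ∈ [v, a, b, c, a₁, a₂, b₁, b₂, c₁, c₂] := by
    have hcard := hG.card_le_ten ht hT hQ
    have h := List.toFinset_card_of_nodup hnd
    have h' : [v, a, b, c, a₁, a₂, b₁, b₂, c₁, c₂].toFinset = Finset.univ := by
      apply Finset.eq_univ_of_card
      have := Finset.card_le_univ [v, a, b, c, a₁, a₂, b₁, b₂, c₁, c₂].toFinset
      simp only [List.length_cons, List.length_nil] at h
      omega
    intro z
    rw [← List.mem_toFinset, h']
    exact Finset.mem_univ z
  have h₁ : (G.Adj a₁ b₁ ∨ G.Adj a₁ b₂) ∧ (G.Adj a₁ c₁ ∨ G.Adj a₁ c₂) := by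
    obtain ⟨m, n, hn⟩ := exists_nbrs_of_adj hG.cubic ha.facts.1.2.1
    have key : ∀ z, G.Adj a₁ z → z = a ∨ z = b₁ ∨ z = b₂ ∨ z = c₁ ∨ z = c₂ := by
      intro z hz
      have hz' := hz.symm
      have := hT z a₁ a hz'
      have := hu z
      simp only [List.mem_cons, List.not_mem_nil, or_false] at this
      simp only [List.nodup_cons, List.mem_cons, List.not_mem_nil, or_false, not_or] at hnd
      clear hT hQ hu hchild
      rcases this with rfl | rfl | rfl | rfl | rfl | rfl | rfl | rfl | rfl | rfl <;>
        grind [→ Nbrs.facts]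
    have hm := key m hn.facts.1.2.1.symm
    have hn' := key n hn.facts.1.2.2.symm
    have hbb : ¬ (G.Adj a₁ b₁ ∧ G.Adj a₁ b₂) := by
      rintro ⟨h1, h2⟩
      rcases hQ b b₁ a₁ b₂ hb.facts.1.2.1.symm h1.symm h2 hb.facts.1.2.2 with h | h <;>
        simp [h] at hnd
    have hcc : ¬ (G.Adj a₁ c₁ ∧ G.Adj a₁ c₂) := by
      rintro ⟨h1, h2⟩
      rcases hQ c c₁ a₁ c₂ hc.facts.1.2.1.symm h1.symm h2 hc.facts.1.2.2 with h | h <;>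
        simp [h] at hnd
    clear * - hm hn' hbb hcc hn
    grind [→ Nbrs.facts]
  have main := fun {b₁ b₂ c₁ c₂ : V} => nonempty_iso_petersen_of_girth hG.conn hG.cubic hT hQ
    (b₁ := b₁) (b₂ := b₂) (c₁ := c₁) (c₂ := c₂) hv ha
  have hu' : ∀ {b₁ b₂ c₁ c₂ : V}, (∀ z, z ∈ [v, a, b, c, a₁, a₂, b₁, b₂, c₁, c₂]) →
      (∀ z, z ∈ [v, a, b, c, a₁, a₂, b₂, b₁, c₁, c₂]) ∧
        (∀ z, z ∈ [v, a, b, c, a₁, a₂, b₁, b₂, c₂, c₁]) := by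
    intro b₁ b₂ c₁ c₂ hu
    constructor <;> intro z <;> have := hu z <;>
      simp only [List.mem_cons, List.not_mem_nil, or_false] at this ⊢ <;> tauto
  have hnd' : ∀ {b₁ b₂ c₁ c₂ : V}, [v, a, b, c, a₁, a₂, b₁, b₂, c₁, c₂].Nodup →
      [v, a, b, c, a₁, a₂, b₂, b₁, c₁, c₂].Nodup ∧
        [v, a, b, c, a₁, a₂, b₁, b₂, c₂, c₁].Nodup := by
    intro b₁ b₂ c₁ c₂ hnd
    refine ⟨(List.Perm.nodup_iff ?_).1 hnd, (List.Perm.nodup_iff ?_).1 hnd⟩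
    · exact (List.Perm.swap b₂ b₁ [c₁, c₂]).append_left [v, a, b, c, a₁, a₂]
    · exact (List.Perm.swap c₂ c₁ []).append_left [v, a, b, c, a₁, a₂, b₁, b₂]
  rcases h₁ with ⟨hab | hab, hac | hac⟩
  · exact main hb hc hnd hu hab hac
  · exact main hb hc.swap (hnd' hnd).2 (hu' hu).2 hab hac
  · exact main hb.swap hc (hnd' hnd).1 (hu' hu).1 hab hac
  · exact main hb.swap hc.swap (hnd' (hnd' hnd).1).2 (hu' (hu' hu).1).2 hab hac

/-- Extremal graphs without adjacent twins. -/
theorem Extremal.iso_of_twinFree (hG : Extremal G) (ht : TwinFree G) :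
    Nonempty (G ≃g K33) ∨ Nonempty (G ≃g K3boxK2) ∨ Nonempty (G ≃g Q3) ∨ Nonempty (G ≃g TQ3) ∨
      Nonempty (G ≃g petersen) := by
  by_cases hT : ∃ a b c, G.Adj a b ∧ G.Adj b c ∧ G.Adj a c
  · obtain ⟨a, b, c, hab, hbc, hac⟩ := hT
    exact Or.inr (Or.inl (hG.iso_of_triangle ht hab hac hbc))
  push Not at hT
  by_cases hQ : ∃ a b c d, G.Adj a b ∧ G.Adj b c ∧ G.Adj c d ∧ G.Adj d a ∧ a ≠ c ∧ b ≠ d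
  · obtain ⟨a, b, c, d, hab, hbc, hcd, hda, hac, hbd⟩ := hQ
    rcases hG.iso_of_square ht hT hab hbc hcd hda hac hbd with h | h | h <;> simp [h]
  push Not at hQ
  simp only [← or_iff_not_imp_left] at hQ
  simp [hG.iso_petersen ht hT hQ]

end LargeGirth

/-! ### Diamonds and copies of Y -/

/-- A diamond on `a`, `x`, `y`, `b` whose vertices `a`, `b` of degree 2 have the outer neighbors
`a'`, `b'`. -/
structure Diamond {V : Type*} (G : SimpleGraph V) (x y a b a' b' : V) : Prop where
  nx : Nbrs G x y a b
  ny : Nbrs G y x a b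
  na : Nbrs G a x y a'
  nb : Nbrs G b x y b'
  ne : a' ≠ b

/-- A copy of `Y` on `x`, `y`, `a`, `b`, `p`, in which `p` has degree 2 and outer neighbor `q`. -/
structure YBlock {V : Type*} (G : SimpleGraph V) (x y a b p q : V) : Prop where
  nx : Nbrs G x y a b
  ny : Nbrs G y x a b
  na : Nbrs G a x y p
  nb : Nbrs G b x y p
  np : Nbrs G p a b q

/-- Distinct copies of `Y` attached to the same vertex are disjoint. -/
theorem YBlock.disjoint {V : Type*} {G : SimpleGraph V} {x y a b p q z w c e r : V}
    (h : YBlock G x y a b p q)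
    (h' : YBlock G z w c e r q) (hz : z ∉ [a, b, x, y, p]) (hw : w ∉ [a, b, x, y, p])
    (hpr : p ≠ r) : List.Disjoint [a, b, x, y, p] [c, e, z, w, r] := by
  obtain ⟨nx, ny, na, nb, np⟩ := h
  obtain ⟨nz, nw, nc, ne, nr⟩ := h'
  intro t ht ht'
  simp only [List.mem_cons, List.not_mem_nil, or_false] at hz hw ht ht'
  rcases ht with rfl | rfl | rfl | rfl | rfl <;> grind [→ Nbrs.facts]

theorem YBlock.nodup {V : Type*} {G : SimpleGraph V} {x y a b p q : V}
    (h : YBlock G x y a b p q) : [a, b, x, y, p].Nodup := by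
  obtain ⟨nx, ny, na, nb, np⟩ := h
  simp
  grind [→ Nbrs.facts]

theorem YBlock.exit_notMem {V : Type*} {G : SimpleGraph V} {x y a b p q : V}
    (h : YBlock G x y a b p q) : q ∉ [a, b, x, y, p] := by
  obtain ⟨nx, ny, na, nb, np⟩ := h
  simp
  grind [→ Nbrs.facts]

theorem YBlock.adj {V : Type*} {G : SimpleGraph V} {x y a b p q : V}
    (h : YBlock G x y a b p q) :
    G.Adj q p ∧ G.Adj a x ∧ G.Adj a y ∧ G.Adj a p ∧ G.Adj b x ∧ G.Adj b y ∧ G.Adj b p ∧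
      G.Adj x y := by
  obtain ⟨nx, ny, na, nb, np⟩ := h
  grind [→ Nbrs.facts]

theorem nonempty_iso_Y3_of_yBlocks {V : Type*} [Fintype V] {G : SimpleGraph V}
    [DecidableRel G.Adj] (hc : G.Connected) (h3 : G.IsRegularOfDegree 3)
    {x₁ y₁ a₁ b₁ p₁ x₂ y₂ a₂ b₂ p₂ x₃ y₃ a₃ b₃ p₃ q : V} (h₁ : YBlock G x₁ y₁ a₁ b₁ p₁ q)
    (h₂ : YBlock G x₂ y₂ a₂ b₂ p₂ q) (h₃ : YBlock G x₃ y₃ a₃ b₃ p₃ q)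
    (d₁₂ : List.Disjoint [a₁, b₁, x₁, y₁, p₁] [a₂, b₂, x₂, y₂, p₂])
    (d₁₃ : List.Disjoint [a₁, b₁, x₁, y₁, p₁] [a₃, b₃, x₃, y₃, p₃])
    (d₂₃ : List.Disjoint [a₂, b₂, x₂, y₂, p₂] [a₃, b₃, x₃, y₃, p₃]) : Nonempty (G ≃g Y3) := by
  have hnd : (q :: ([a₁, b₁, x₁, y₁, p₁] ++
      ([a₂, b₂, x₂, y₂, p₂] ++ [a₃, b₃, x₃, y₃, p₃]))).Nodup := by
    rw [List.nodup_cons, List.mem_append, List.mem_append, List.nodup_append', List.nodup_append',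
      List.disjoint_append_right]
    exact ⟨not_or.2 ⟨h₁.exit_notMem, not_or.2 ⟨h₂.exit_notMem, h₃.exit_notMem⟩⟩, h₁.nodup,
      ⟨h₂.nodup, h₃.nodup, d₂₃⟩, d₁₂, d₁₃⟩
  refine nonempty_iso_Y3 hc h3 hnd ?_
  obtain ⟨e1, e2, e3, e4, e5, e6, e7, e8⟩ := h₁.adj
  obtain ⟨f1, f2, f3, f4, f5, f6, f7, f8⟩ := h₂.adj
  obtain ⟨g1, g2, g3, g4, g5, g6, g7, g8⟩ := h₃.adj
  exact ⟨e1, f1, g1, e2, e3, e4, e5, e6, e7, e8, f2, f3, f4, f5, f6, f7, f8, g2, g3, g4, g5, g6,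
    g7, g8⟩

/-- If `t` were `p` or `r`, or if `t = q` and `u = p`, the vertex `k` would lie in one of the first
two copies. Only the third edge at `q` remains. -/
theorem YBlock.eq_of_third {V : Type*} [DecidableEq V] {G : SimpleGraph V}
    {x y a b p q z w c e r s k l f g t u : V}
    (h : YBlock G x y a b p q) (h' : YBlock G z w c e r q) (nq : Nbrs G q p r s)
    (h'' : YBlock G k l f g t u) (hqu : q = u ∨ (t = q ∧ p = u))
    (hk : k ∉ ({z, w, c, e, r, s, q, p, x, y, a, b} : Finset V)) : q = u ∧ t = s := by
  obtain ⟨nx, ny, na, nb, np⟩ := h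
  obtain ⟨nz, nw, nc, ne, nr⟩ := h'
  obtain ⟨nk, nl, nf, ng, nt⟩ := h''
  simp only [Finset.mem_insert, Finset.mem_singleton, not_or] at hk
  rcases hqu with rfl | ⟨rfl, rfl⟩
  · refine ⟨rfl, ?_⟩
    rcases (nq.adj_iff t).1 nt.facts.1.2.2 with rfl | rfl | h
    · exfalso
      have := (np.adj_iff f).1 nt.facts.1.1.symm
      grind [→ Nbrs.facts]
    · exfalso
      have := (nr.adj_iff f).1 nt.facts.1.1.symm
      grind [→ Nbrs.facts]
    · exact h
  · exfalso
    grind [→ Nbrs.facts]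

theorem YBlock.ne_of_notMem {V : Type*} [DecidableEq V] {G : SimpleGraph V}
    {x y a b p q z w c e r : V} (h : YBlock G x y a b p q)
    (h' : YBlock G z w c e r q) (hz : z ∉ ({q, p, x, y, a, b} : Finset V)) : p ≠ r := by
  rintro rfl
  obtain ⟨nx, ny, na, nb, np⟩ := h
  obtain ⟨nz, nw, nc, ne, nr⟩ := h'
  simp only [Finset.mem_insert, Finset.mem_singleton] at hz
  grind [→ Nbrs.facts]

/-! ### Graphs with twins -/

section Twins

variable {V : Type*} [Fintype V] [DecidableEq V] {G : SimpleGraph V} [DecidableRel G.Adj]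

/-- Twins are adjacent and share their two other neighbors `a`, `b`. If these were adjacent, the
four vertices would form a K_4 with no edge leaving it, and `hK` excludes that. -/
theorem Extremal.exists_diamond (hG : Extremal G) (hK : ∃ u v, u ≠ v ∧ ¬ G.Adj u v) {x y : V}
    (hxy : x ≠ y) (h : closedNbhdFinset G x = closedNbhdFinset G y) :
    ∃ a b a' b', Diamond G x y a b a' b' := by
  have hadj : G.Adj x y := by
    have := h ▸ self_mem_closedNbhdFinset (G := G) y
    exact (mem_closedNbhdFinset.1 this).resolve_left hxy.symm
  obtain ⟨a, b, nx⟩ := exists_nbrs_of_adj hG.cubic hadj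
  have hy : ∀ z, y ≠ z → G.Adj x z → G.Adj y z := by
    intro z hz hxz
    have := h ▸ mem_closedNbhdFinset.2 (Or.inr hxz)
    exact (mem_closedNbhdFinset.1 this).resolve_left hz.symm
  have hya := hy a nx.ne₁₂ nx.facts.1.2.1.symm
  have hyb := hy b nx.ne₁₃ nx.facts.1.2.2.symm
  have ny := exists_nbrs_of_adj₃ hG.cubic hadj.symm hya hyb nx.facts.1.2.1.ne'
    nx.facts.1.2.2.ne' nx.ne₂₃
  obtain ⟨a', na⟩ := exists_nbrs_of_adj₂ hG.cubic nx.facts.1.2.1 hya.symm hxy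
  obtain ⟨b', nb⟩ := exists_nbrs_of_adj₂ hG.cubic nx.facts.1.2.2 hyb.symm hxy
  refine ⟨a, b, a', b', nx, ny, na, nb, ?_⟩
  rintro rfl
  have nb := exists_nbrs_of_adj₃ hG.cubic nx.facts.1.2.2 hyb.symm na.facts.1.2.2 hxy
    nx.facts.1.2.1.ne' ny.facts.1.2.1.ne'
  have hu : ({x, y, a, a'} : Finset V) = Finset.univ := by
    by_contra hne
    obtain ⟨d, hd, hsub⟩ := exists_boundary hG.conn ⟨x, by simp⟩ hne
    apply hsub
    intro z
    simp only [Finset.mem_insert, Finset.mem_singleton] at hd ⊢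
    rcases hd with rfl | rfl | rfl | rfl
    · rw [nx.mem_iff]; tauto
    · rw [ny.mem_iff]; tauto
    · rw [na.mem_iff]; tauto
    · rw [nb.mem_iff]; tauto
  obtain ⟨u, v, huv, hnadj⟩ := hK
  have hu' := hu ▸ Finset.mem_univ u
  have hv' := hu ▸ Finset.mem_univ v
  simp only [Finset.mem_insert, Finset.mem_singleton] at hu' hv'
  clear hu
  rcases hu' with rfl | rfl | rfl | rfl <;> grind [→ Nbrs.facts]

theorem Diamond.yBlock (hG : Extremal G) {x y a b p : V} (h : Diamond G x y a b p p) :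
    ∃ q, YBlock G x y a b p q := by
  obtain ⟨q, np⟩ := exists_nbrs_of_adj₂ hG.cubic h.na.facts.1.2.2 h.nb.facts.1.2.2 h.nx.ne₂₃
  exact ⟨q, h.nx, h.ny, h.na, h.nb, np⟩

/-- The terms are `x`, `a`, `p`: the last two gain only `p` and `q`. -/
theorem YBlock.excess (hG : Extremal G) {x y a b p q : V} (h : YBlock G x y a b p q) :
    Excess G {q, p, x, y, a, b} 0 := by
  obtain ⟨nx, ny, na, nb, np⟩ := h
  have h1 : Excess G {x, y, a, b} 2 := .of_nbrs hG.cubic nx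
  have h2 : Excess G {p, x, y, a, b} 1 := by
    refine h1.insert₁ (v := a) ?_ ?_ ?_ ?_ <;>
      (try simp only [Finset.mem_insert, Finset.mem_singleton]) <;> clear h1 <;>
      grind [→ Nbrs.facts]
  refine h2.insert₁ (v := p) ?_ ?_ ?_ ?_ <;>
    (try simp only [Finset.mem_insert, Finset.mem_singleton]) <;> clear h1 h2 <;>
    grind [→ Nbrs.facts]

theorem YBlock.ne_univ (hG : Extremal G) {x y a b p q : V} (h : YBlock G x y a b p q) :
    ({q, p, x, y, a, b} : Finset V) ≠ Finset.univ := by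
  intro hu
  obtain ⟨nx, ny, na, nb, np⟩ := h
  obtain ⟨m, n, nq⟩ := exists_nbrs_of_adj hG.cubic np.facts.1.2.2
  have hm := hu ▸ Finset.mem_univ m
  simp only [Finset.mem_insert, Finset.mem_singleton] at hm
  clear hu hG
  rcases hm with rfl | rfl | rfl | rfl | rfl | rfl <;> grind [→ Nbrs.facts]

theorem Diamond.excess (hG : Extremal G) {x y a b a' b' : V} (h : Diamond G x y a b a' b')
    (hab : a' ≠ b') : Excess G {b', a', x, y, a, b} 0 := by
  obtain ⟨nx, ny, na, nb, hne⟩ := h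
  have h1 : Excess G {x, y, a, b} 2 := .of_nbrs hG.cubic nx
  have h2 : Excess G {a', x, y, a, b} 1 := by
    refine h1.insert₁ (v := a) ?_ ?_ ?_ ?_ <;>
      (try simp only [Finset.mem_insert, Finset.mem_singleton]) <;> clear h1 <;>
      grind [→ Nbrs.facts]
  refine h2.insert₁ (v := b) ?_ ?_ ?_ ?_ <;>
    (try simp only [Finset.mem_insert, Finset.mem_singleton]) <;> clear h1 h2 <;>
    grind [→ Nbrs.facts]

theorem Diamond.ne_univ (hG : Extremal G) {x y a b a' b' : V} (h : Diamond G x y a b a' b')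
    (hab : a' ≠ b') : ({b', a', x, y, a, b} : Finset V) ≠ Finset.univ := by
  intro hu
  obtain ⟨nx, ny, na, nb, hne⟩ := h
  obtain ⟨m, n, nq⟩ := exists_nbrs_of_adj hG.cubic na.facts.1.2.2
  have key : ∀ m, G.Adj a' m → m = a ∨ m = b' := by
    intro m hm
    have hm' := hm.symm
    have := hm.ne
    have h := hu ▸ Finset.mem_univ m
    simp only [Finset.mem_insert, Finset.mem_singleton] at h
    clear hu hG nq
    rcases h with rfl | rfl | rfl | rfl | rfl | rfl <;> grind [→ Nbrs.facts]
  have hm := key m nq.facts.1.2.1.symm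
  have hn := key n nq.facts.1.2.2.symm
  clear * - hm hn nq
  grind [→ Nbrs.facts]

/-- The set of excess 0 around the diamond leaves another pair of twins. If their diamond closes up
to a copy of Y, its own set of excess 0 violates `Extremal.mem_of_twins` for the first diamond.
Otherwise that lemma, applied to the second diamond, identifies its degree-2 vertices with `a'` and
`b'`. -/
theorem Extremal.iso_NYY (hG : Extremal G) (hK : ∃ u v, u ≠ v ∧ ¬ G.Adj u v) {x y a b a' b' : V}
    (h : Diamond G x y a b a' b') (hab : a' ≠ b') : Nonempty (G ≃g NYY) := by
  obtain ⟨z, w, hz, hw, hzw, htw⟩ := hG.exists_twins (h.excess hG hab) (h.ne_univ hG hab)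
  obtain ⟨c, e, c', e', hd⟩ := hG.exists_diamond hK hzw htw
  simp only [Finset.mem_insert, Finset.mem_singleton] at hz hw
  by_cases hce : c' = e'
  · subst hce
    exfalso
    obtain ⟨q, hY⟩ := hd.yBlock hG
    have hm := hG.mem_of_twins (hY.excess hG) h.nx h.ny h.na h.nb hab
    obtain ⟨nx, ny, na, nb, hne⟩ := h
    obtain ⟨nz, nw, nc, ne, np⟩ := hY
    simp only [Finset.mem_insert, Finset.mem_singleton] at hm
    clear hd htw hK hG
    have hx : ¬ (x = q ∨ x = c' ∨ x = z ∨ x = w ∨ x = c ∨ x = e) := by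
      rintro (rfl | rfl | rfl | rfl | rfl | rfl) <;> grind [→ Nbrs.facts]
    have hy : ¬ (y = q ∨ y = c' ∨ y = z ∨ y = w ∨ y = c ∨ y = e) := by
      rintro (rfl | rfl | rfl | rfl | rfl | rfl) <;> grind [→ Nbrs.facts]
    obtain ⟨ha, hb⟩ := hm hx hy
    rcases ha with rfl | rfl | rfl | rfl | rfl | rfl <;> grind [→ Nbrs.facts]
  · have hm := hG.mem_of_twins (h.excess hG hab) hd.nx hd.ny hd.na hd.nb hce
    obtain ⟨nx, ny, na, nb, hne⟩ := h
    obtain ⟨nz, nw, nc, ne, hne'⟩ := hd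
    simp only [Finset.mem_insert, Finset.mem_singleton] at hm
    obtain ⟨hc, he⟩ := hm hz hw
    have key : (c = a' ∧ e = b') ∨ (c = b' ∧ e = a') := by
      clear htw hK hm hG
      grind [→ Nbrs.facts]
    rcases key with ⟨rfl, rfl⟩ | ⟨rfl, rfl⟩
    · refine nonempty_iso_NYY hG.conn hG.cubic (a := a) (b := b) (x := x) (y := y) (c := c)
        (d := e) (z := z) (w := w) ?_ ?_
      · simp
        clear htw hK hm hG
        grind [→ Nbrs.facts]
      · clear htw hK hm hG
        grind [→ Nbrs.facts]
    · refine nonempty_iso_NYY hG.conn hG.cubic (a := a) (b := b) (x := x) (y := y) (c := e)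
        (d := c) (z := z) (w := w) ?_ ?_
      · simp
        clear htw hK hm hG
        grind [→ Nbrs.facts]
      · clear htw hK hm hG
        grind [→ Nbrs.facts]

/-- The two sets of excess 0 meet by `Extremal.not_disjoint`, as the second can be left only through
`s`. They overlap either in a common outer vertex or along an edge joining the two copies of Y. -/
theorem YBlock.eq_or_eq (hG : Extremal G) {x y a b p q z w c e r s : V}
    (h : YBlock G x y a b p q) (h' : YBlock G z w c e r s)
    (hz : z ∉ ({q, p, x, y, a, b} : Finset V)) (hw : w ∉ ({q, p, x, y, a, b} : Finset V)) :
    q = s ∨ (r = q ∧ p = s) := by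
  have hexit : ∀ u ∈ ({s, r, z, w, c, e} : Finset V), ∀ v ∉ ({s, r, z, w, c, e} : Finset V),
      G.Adj u v → u = s := by
    obtain ⟨nz, nw, nc, ne, nr⟩ := h'
    intro u hu v hv huv
    simp only [Finset.mem_insert, Finset.mem_singleton] at hu hv
    clear hz hw hG
    rcases hu with rfl | rfl | rfl | rfl | rfl | rfl <;> grind [→ Nbrs.facts]
  obtain ⟨t, ht, ht'⟩ := Finset.not_disjoint_iff.1
    (hG.not_disjoint (h.excess hG) (h'.excess hG) hexit)
  obtain ⟨nx, ny, na, nb, np⟩ := h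
  obtain ⟨nz, nw, nc, ne, nr⟩ := h'
  simp only [Finset.mem_insert, Finset.mem_singleton] at hz hw ht ht'
  clear hexit hG
  rcases ht with rfl | rfl | rfl | rfl | rfl | rfl <;> grind [→ Nbrs.facts]

theorem YBlock.ne_univ₂ (hG : Extremal G) {x y a b p q z w c e r s : V}
    (h : YBlock G x y a b p q) (h' : YBlock G z w c e r q) (nq : Nbrs G q p r s)
    (hz : z ∉ ({q, p, x, y, a, b} : Finset V)) (hw : w ∉ ({q, p, x, y, a, b} : Finset V)) :
    ({z, w, c, e, r, s, q, p, x, y, a, b} : Finset V) ≠ Finset.univ := by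
  intro hu
  obtain ⟨m, n, ns⟩ := exists_nbrs_of_adj hG.cubic nq.facts.1.2.2
  have hm := hu ▸ Finset.mem_univ m
  have hms := ns.facts.1.2.1
  have hsm := hms.ne
  have hmq : q ≠ m := ns.ne₁₂
  obtain ⟨nx, ny, na, nb, np⟩ := h
  obtain ⟨nz, nw, nc, ne, nr⟩ := h'
  simp only [Finset.mem_insert, Finset.mem_singleton] at hm hz hw
  clear hu hG ns
  rcases hm with rfl | rfl | rfl | rfl | rfl | rfl | rfl | rfl | rfl | rfl | rfl | rfl <;>
    grind [→ Nbrs.facts]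

/-- Continuing with `q`, `r`, `c` absorbs the second copy of Y and `s` without excess. Something
remains undominated, so there are new twins; `hY` puts them in a copy of Y, which must hang on the
third edge at `q`. -/
theorem Extremal.exists_third_yBlock (hG : Extremal G) (hK : ∃ u v, u ≠ v ∧ ¬ G.Adj u v)
    (hY : ∀ x y a b a' b', Diamond G x y a b a' b' → a' = b') {x y a b p q z w c e r s : V}
    (h : YBlock G x y a b p q) (h' : YBlock G z w c e r q) (nq : Nbrs G q p r s)
    (hz : z ∉ ({q, p, x, y, a, b} : Finset V)) (hw : w ∉ ({q, p, x, y, a, b} : Finset V)) :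
    ∃ k l f g, k ∉ ({z, w, c, e, r, s, q, p, x, y, a, b} : Finset V) ∧
      l ∉ ({z, w, c, e, r, s, q, p, x, y, a, b} : Finset V) ∧ YBlock G k l f g s q := by
  have e1 : Excess G {r, s, q, p, x, y, a, b} 0 :=
    (h.excess hG).insert₂ hG.cubic (v := q) (by simp) nq.rotate (by simp)
  have e2 : Excess G {c, e, r, s, q, p, x, y, a, b} 0 :=
    e1.insert₂ hG.cubic (v := r) (by simp) h'.np (by simp)
  have e3 : Excess G {z, w, c, e, r, s, q, p, x, y, a, b} 0 :=
    e2.insert₂ hG.cubic (v := c) (by simp) h'.na (by simp)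
  obtain ⟨k, l, hk, hl, hkl, htw⟩ := hG.exists_twins e3 (h.ne_univ₂ hG h' nq hz hw)
  obtain ⟨f, g, t, t', hd⟩ := hG.exists_diamond hK hkl htw
  obtain rfl := hY _ _ _ _ _ _ hd
  obtain ⟨u, h''⟩ := hd.yBlock hG
  have hsub : ({q, p, x, y, a, b} : Finset V) ⊆ {z, w, c, e, r, s, q, p, x, y, a, b} := by
    intro v hv
    simp only [Finset.mem_insert] at hv ⊢
    simp only [hv, or_true]
  have hqu := h.eq_or_eq hG h'' (fun h => hk (hsub h)) (fun h => hl (hsub h))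
  obtain ⟨rfl, rfl⟩ := h.eq_of_third h' nq h'' hqu hk
  exact ⟨k, l, f, g, hk, hl, h''⟩

theorem Extremal.iso_Y3 (hG : Extremal G) (hK : ∃ u v, u ≠ v ∧ ¬ G.Adj u v)
    (hY : ∀ x y a b a' b', Diamond G x y a b a' b' → a' = b') {x y a b p q z w c e r : V}
    (h : YBlock G x y a b p q) (h' : YBlock G z w c e r q)
    (hz : z ∉ ({q, p, x, y, a, b} : Finset V)) (hw : w ∉ ({q, p, x, y, a, b} : Finset V)) :
    Nonempty (G ≃g Y3) := by
  have hpr := h.ne_of_notMem h' hz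
  obtain ⟨s, nq⟩ := exists_nbrs_of_adj₂ hG.cubic h.np.facts.1.2.2 h'.np.facts.1.2.2 hpr
  obtain ⟨k, l, f, g, hk, hl, h''⟩ := hG.exists_third_yBlock hK hY h h' nq hz hw
  simp only [Finset.mem_insert, Finset.mem_singleton, not_or] at hk hl hz hw
  exact nonempty_iso_Y3_of_yBlocks hG.conn hG.cubic h h' h''
    (h.disjoint h' (by simp [hz]) (by simp [hw]) hpr)
    (h.disjoint h'' (by simp [hk]) (by simp [hl]) nq.ne₁₃)
    (h'.disjoint h'' (by simp [hk]) (by simp [hl]) nq.ne₂₃)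

/-- A second copy of Y always exists. It shares the outer vertex, leading to Y_3, or is joined
directly to the first, giving Y_2. -/
theorem Extremal.iso_Y2_or_Y3 (hG : Extremal G) (hK : ∃ u v, u ≠ v ∧ ¬ G.Adj u v)
    (hY : ∀ x y a b a' b', Diamond G x y a b a' b' → a' = b') {x y a b p q : V}
    (h : YBlock G x y a b p q) : Nonempty (G ≃g Y2) ∨ Nonempty (G ≃g Y3) := by
  obtain ⟨z, w, hz, hw, hzw, htw⟩ := hG.exists_twins (h.excess hG) (h.ne_univ hG)
  obtain ⟨c, e, r, r', hd⟩ := hG.exists_diamond hK hzw htw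
  obtain rfl := hY _ _ _ _ _ _ hd
  obtain ⟨s, h'⟩ := hd.yBlock hG
  rcases h.eq_or_eq hG h' hz hw with rfl | ⟨rfl, rfl⟩
  · exact Or.inr (hG.iso_Y3 hK hY h h' hz hw)
  · left
    have hdis : List.Disjoint [a, b, x, y, p] [c, e, z, w, r] := by
      obtain ⟨nx, ny, na, nb, np⟩ := h
      obtain ⟨nz, nw, nc, ne, nr⟩ := h'
      simp only [Finset.mem_insert, Finset.mem_singleton] at hz hw
      intro t ht ht'
      simp only [List.mem_cons, List.not_mem_nil, or_false] at ht ht'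
      clear hY hK hG htw hd
      rcases ht with rfl | rfl | rfl | rfl | rfl <;> grind [→ Nbrs.facts]
    have hnd : ([a, b, x, y, p] ++ [c, e, z, w, r]).Nodup :=
      List.nodup_append'.2 ⟨h.nodup, h'.nodup, hdis⟩
    refine nonempty_iso_Y2 hG.conn hG.cubic hnd ?_
    have h1 := h.adj
    have h2 := h'.adj
    tauto

/-- Extremal graphs with adjacent twins. -/
theorem Extremal.iso_of_twins (hG : Extremal G) (hK : ∃ u v, u ≠ v ∧ ¬ G.Adj u v) {x y : V}
    (hxy : x ≠ y) (h : closedNbhdFinset G x = closedNbhdFinset G y) :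
    Nonempty (G ≃g Y2) ∨ Nonempty (G ≃g Y3) ∨ Nonempty (G ≃g NYY) := by
  by_cases hY : ∀ x y a b a' b', Diamond G x y a b a' b' → a' = b'
  · obtain ⟨a, b, p, p', hd⟩ := hG.exists_diamond hK hxy h
    obtain rfl := hY _ _ _ _ _ _ hd
    obtain ⟨q, h⟩ := hd.yBlock hG
    rcases hG.iso_Y2_or_Y3 hK hY h with h | h <;> simp [h]
  · push Not at hY
    obtain ⟨x, y, a, b, a', b', hd, hab⟩ := hY
    simp [hG.iso_NYY hK hd hab]

end Twins

/-! ### From the Grundy domination number to extremality -/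

theorem extremal_of_grundy_eq {V : Type*} [Fintype V] [DecidableEq V] {G : SimpleGraph V}
    [DecidableRel G.Adj] (hc : G.Connected) (h3 : G.IsRegularOfDegree 3)
    (h : 2 * grundyDominationNumber G = Fintype.card V) : Extremal G := by
  refine ⟨hc, h3, fun D k hk => ?_⟩
  obtain ⟨s, hs, -⟩ := hk.exists_isClosedNbhdSeq
  have := (isGreatest_grundyDominationNumber G).2 ⟨s, hs⟩
  omega

/-- In a complete cubic graph the Grundy domination number is not half the order. -/
theorem exists_not_adj_of_grundy_eq {V : Type*} [Fintype V] {G : SimpleGraph V}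
    [DecidableRel G.Adj] (hc : G.Connected) (h3 : G.IsRegularOfDegree 3)
    (h : 2 * grundyDominationNumber G = Fintype.card V) : ∃ u v, u ≠ v ∧ ¬ G.Adj u v := by
  classical
  by_contra! hK
  obtain ⟨v⟩ := hc.nonempty
  have hcard := (card_closedNbhdFinset h3 v).symm.trans_le (Finset.card_le_univ _)
  obtain ⟨s, hs⟩ := (isGreatest_grundyDominationNumber G).1
  obtain ⟨x, hx⟩ := isClosedNbhdSeq_iff.1 hs
  -- The order is at least 4, so there is a second term; in a complete graph the first term has
  -- already dominated everything.
  refine (hx ⟨1, by omega⟩).2 ⟨0, by omega⟩ (by simp [Fin.lt_def]) ?_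
  rw [mem_closedNbhd, or_iff_not_imp_right]
  exact fun hne => hK _ _ (Ne.symm hne)

end GrundyCubic

theorem mainTheorem4 {V : Type*} [Fintype V] (G : SimpleGraph V) [DecidableRel G.Adj]
    (hconn : G.Connected) (hcubic : G.IsRegularOfDegree 3) :
    (GrundyCubic.grundyDominationNumber G : ℚ) = (Fintype.card V : ℚ) / 2 ↔
      (Nonempty (G ≃g GrundyCubic.K33) ∨ Nonempty (G ≃g GrundyCubic.Y2) ∨
        Nonempty (G ≃g GrundyCubic.Y3) ∨ Nonempty (G ≃g GrundyCubic.NYY) ∨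
        Nonempty (G ≃g GrundyCubic.K3boxK2) ∨ Nonempty (G ≃g GrundyCubic.Q3) ∨
        Nonempty (G ≃g GrundyCubic.TQ3) ∨ Nonempty (G ≃g GrundyCubic.petersen)) := by
  classical
  constructor
  · intro h
    have h' : 2 * GrundyCubic.grundyDominationNumber G = Fintype.card V := by
      have : (2 * GrundyCubic.grundyDominationNumber G : ℚ) = Fintype.card V := by
        rw [h]
        ring
      exact_mod_cast this
    have hG := GrundyCubic.extremal_of_grundy_eq hconn hcubic h'
    by_cases ht : GrundyCubic.TwinFree G
    · rcases hG.iso_of_twinFree ht with h | h | h | h | h <;> simp [h]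
    · simp only [GrundyCubic.TwinFree, not_forall] at ht
      obtain ⟨x, y, h, hxy⟩ := ht
      have hK := GrundyCubic.exists_not_adj_of_grundy_eq hconn hcubic h'
      rcases hG.iso_of_twins hK hxy h with h | h | h <;> simp [h]
  · rintro (⟨⟨e⟩⟩ | ⟨⟨e⟩⟩ | ⟨⟨e⟩⟩ | ⟨⟨e⟩⟩ | ⟨⟨e⟩⟩ | ⟨⟨e⟩⟩ | ⟨⟨e⟩⟩ | ⟨⟨e⟩⟩)
    · exact GrundyCubic.grundy_eq_half_of_iso GrundyCubic.grundy_K33 (by simp) e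
    · exact GrundyCubic.grundy_eq_half_of_iso GrundyCubic.grundy_Y2 (by simp) e
    · exact GrundyCubic.grundy_eq_half_of_iso GrundyCubic.grundy_Y3 (by simp) e
    · exact GrundyCubic.grundy_eq_half_of_iso GrundyCubic.grundy_NYY (by simp) e
    · exact GrundyCubic.grundy_eq_half_of_iso GrundyCubic.grundy_K3boxK2 (by simp) e
    · exact GrundyCubic.grundy_eq_half_of_iso GrundyCubic.grundy_Q3 (by simp) e
    · exact GrundyCubic.grundy_eq_half_of_iso GrundyCubic.grundy_TQ3 (by simp) e
    · exact GrundyCubic.grundy_eq_half_of_iso GrundyCubic.grundy_petersen (by simp) e
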